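/- Let $q$ be a prime power and let $b>1$ and $d$ be integers such that $b\mid d$ and $d/b\ge 4$ is even. Let $V'=\mathbb F_{q^b}^{d/b}$ and let $$Q'(x)=x_1x_2+x_3x_4+\cdots+x_{d/b-3}x_{d/b-2}+x_{d/b-1}^2+a_0x_{d/b-1}x_{d/b}+a_1x_{d/b}^2,$$ where $a_0,a_1\in\mathbb F_{q^b}$ are such that $X^2+a_0X+a_1$ is irreducible over $\mathbb F_{q^b}$. Regard $V'$ as a $d$-dimensional vector space $V$ over $\mathbb F_q$ with the quadratic form $Q=\mathrm{Tr}_{q^b/q}\circ Q'$, and let $Q^-(d-1,q)$ be the polar space of $Q$: its points are the one-dimensional totally singular $\mathbb F_q$-subspaces of $V$, and its generators are the maximal totally singular $\mathbb F_q$-subspaces of $V$. An $m$-ovoid of it is a set of points that meets every generator in exactly $m$ points. Let $\square$ be the set of nonzero squares of $\mathbb F_q$, let $\mathcal T$ be a nonempty subset of $\mathbb F_{q^b}^*$ that is invariant under multiplication by $\square$ and all of whose elements have relative trace $0$ to $\mathbb F_q$, and let $T$ be a set of representatives of the $\square$-cosets contained in $\mathcal T$, so that $\mathcal T=\square\cdot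 T$. Put $\mathcal M=\{\langle v\rangle_{\mathbb F_q} : v \in V,\ Q'(v)\in\mathcal T\}$, and let $\epsilon=\tfrac12$ if $q$ is odd and $\epsilon=1$ if $q$ is even. If $\mathcal M$ is an $\epsilon|T|q^{d/2-b}$-ovoid of $Q^-(d-1,q)$, then $$|T|\ge\frac{q^b}{\epsilon(q-1)(2q^{b/2}+1)}.$$ -/

import Mathlib

/-- A subspace is totally singular for the quadratic form `Q` if `Q` vanishes on it. -/
def TotallySingular {F V : Type*} [Field F] [AddCommGroup V] [Module F V]
    (Q : QuadraticForm F V) (W : Submodule F V) : Prop :=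
  ∀ w ∈ W, Q w = 0

/-- The points of the polar space of `Q`: the one-dimensional totally singular subspaces. -/
def polarPoints {F V : Type*} [Field F] [AddCommGroup V] [Module F V]
    (Q : QuadraticForm F V) : Set (Submodule F V) :=
  {P | Module.finrank F P = 1 ∧ TotallySingular Q P}

/-- The generators of the polar space of `Q`: the maximal totally singular subspaces. -/
def IsGenerator {F V : Type*} [Field F] [AddCommGroup V] [Module F V]
    (Q : QuadraticForm F V) (W : Submodule F V) : Prop :=
  Maximal (TotallySingular Q) W

/-- An `m`-ovoid of the polar space of `Q`: a set of points of the polar space that meets each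
generator in exactly `m` points. -/
def IsMOvoid {F V : Type*} [Field F] [AddCommGroup V] [Module F V]
    (Q : QuadraticForm F V) (m : ℕ) (M : Set (Submodule F V)) : Prop :=
  M ⊆ polarPoints Q ∧ ∀ W, IsGenerator Q W → {P ∈ M | P ≤ W}.encard = m

/-- The quadratic form
`x₁x₂ + x₃x₄ + ⋯ + x₂ₖ₋₁x₂ₖ + x₂ₖ₊₁² + a₀ x₂ₖ₊₁x₂ₖ₊₂ + a₁ x₂ₖ₊₂²` on `E^(2k+2)`
(the coordinates are numbered from `0` in the code). -/
noncomputable def ellipticForm (E : Type*) [Field E] (k : ℕ) (a₀ a₁ : E) :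
    QuadraticForm E (Fin (2 * k + 2) → E) :=
  (∑ i : Fin k, QuadraticMap.proj (R := E) (A := E)
      (⟨2 * i, by omega⟩ : Fin (2 * k + 2)) ⟨2 * i + 1, by omega⟩)
    + QuadraticMap.proj (R := E) (A := E)
        (⟨2 * k, by omega⟩ : Fin (2 * k + 2)) ⟨2 * k, by omega⟩
    + a₀ • QuadraticMap.proj (R := E) (A := E)
        (⟨2 * k, by omega⟩ : Fin (2 * k + 2)) ⟨2 * k + 1, by omega⟩
    + a₁ • QuadraticMap.proj (R := E) (A := E)
        (⟨2 * k + 1, by omega⟩ : Fin (2 * k + 2)) ⟨2 * k + 1, by omega⟩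

theorem ellipticForm_apply (E : Type*) [Field E] (k : ℕ) (a₀ a₁ : E)
    (x : Fin (2 * k + 2) → E) :
    ellipticForm E k a₀ a₁ x =
      (∑ i : Fin k, x ⟨2 * i, by omega⟩ * x ⟨2 * i + 1, by omega⟩)
        + x ⟨2 * k, by omega⟩ ^ 2
        + a₀ * x ⟨2 * k, by omega⟩ * x ⟨2 * k + 1, by omega⟩
        + a₁ * x ⟨2 * k + 1, by omega⟩ ^ 2 := by
  simp [ellipticForm, sq, mul_assoc]

/-- The form `Tr_{E/F} ∘ Q'`, a quadratic form on the vector space `V'` regarded over `F`. -/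
noncomputable def traceForm (F : Type*) {E V' : Type*} [Field F] [Field E] [Algebra F E]
    [AddCommGroup V'] [Module E V'] [Module F V'] [IsScalarTower F E V']
    (Q' : QuadraticForm E V') : QuadraticForm F V' :=
  (Algebra.trace F E).compQuadraticMap' Q'

theorem traceForm_apply (F : Type*) {E V' : Type*} [Field F] [Field E] [Algebra F E]
    [AddCommGroup V'] [Module E V'] [Module F V'] [IsScalarTower F E V']
    (Q' : QuadraticForm E V') (x : V') : traceForm F Q' x = Algebra.trace F E (Q' x) := rfl

/-- The set of nonzero squares of a field. -/
def nonzeroSquares (F : Type*) [Field F] : Set F := {c | c ≠ 0 ∧ IsSquare c}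

/-- `T` is a set of representatives of the cosets, modulo the nonzero squares of `F`, that make
up `S`. -/
def IsSquareCosetReps (F : Type*) {E : Type*} [Field F] [Field E] [Algebra F E]
    (S : Set E) (T : Finset E) : Prop :=
  (T : Set E) ⊆ S ∧ ∀ x ∈ S, ∃! t, t ∈ T ∧ ∃ c ∈ nonzeroSquares F, x = c • t

/-- The set of `F`-points `⟨v⟩` with `Q' v ∈ S`. -/
def pointsWithValueIn (F : Type*) {E V' : Type*} [Field F] [Field E]
    [AddCommGroup V'] [Module E V'] [Module F V']
    (Q' : QuadraticForm E V') (S : Set E) : Set (Submodule F V') :=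
  {P | ∃ v : V', v ≠ 0 ∧ Q' v ∈ S ∧ P = Submodule.span F {v}}

/-- `1/2` or `1` according as `q` is odd or even. -/
noncomputable def parityFactor (q : ℕ) : ℝ := if Odd q then 1 / 2 else 1

/-! ### Counting by trace and norm in a quadratic extension. -/

section QuadraticExtension

variable {E L : Type*} [Field E] [Fintype E] [Field L] [Fintype L] [Algebra E L]

/-! Let `X` be the set of vectors whose `Q'`-value lies in `S`, and fix `v ∈ X`. The sum of `ψ
(polar Q v x)` over `x ∈ X` is evaluated in two ways. Every generator contains `μ = (q - 1) * m`
vectors of `X`; this determines `|X|` and `|X ∩ v^⊥|`, and the sum equals `μ - |E|^(k+1)`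
(`HasEllipticGaussSums.card_inter_perp_sub`, `HasEllipticGaussSums.sum_polar_eq`). On the other hand
`X` is the union of the quadrics `Q' = c` with `c ∈ S`, and completing the square turns the sum over
each of them into `-|E|^k` times the Kloosterman sum with parameter `Q'(v) * c ≠ 0`
(`sum_polar_ellipticForm_eq`). Weil's bound `2√|E|` then gives `|E|^(k+1) ≤ (q - 1) * m + 2 |E|^k
|S| √|E|`. Inserting `m` and `|S| ≤ ε (q - 1) |T|` and cancelling `|E|^k` yields the claim.

Weil's bound is proved by elementary means. Kloosterman sums are real, and `K² + K_L = 2|E|` for the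
quadratic extension `L` of `E` (`kloosterman_sq_add`). This bounds `K_L` above by `2|E|`; a lower
bound up to a constant factor comes from Stepanov's method (`card_trace_add_div_eq_le`) and a sum
over the multiples of `ψ`. In each descent from `L` to `E` the identity quarters the excess of the
constant over `2`, so descending from arbitrarily high in a tower of quadratic extensions leaves
exactly `2`. -/

theorem algebraMap_trace_of_finrank_eq_two (h : Module.finrank E L = 2) (z : L) :
    algebraMap E L (Algebra.trace E L z) = z + z ^ Fintype.card E := by
  rw [FiniteField.algebraMap_trace_eq_sum_pow, h]
  simp [Finset.sum_range_succ]

theorem algebraMap_norm_of_finrank_eq_two (h : Module.finrank E L = 2) (z : L) :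
    algebraMap E L (Algebra.norm E z) = z * z ^ Fintype.card E := by
  rw [FiniteField.algebraMap_norm_eq_prod_pow, h]
  simp [Finset.prod_range_succ]

open Classical in
-- Both sets consist of solutions of `X² - sX + p = 0`, as ordered pairs of roots in `E` or as
-- single roots in `L`, so each has at most two elements. If neither is empty, the root in `L` lies
-- in `E`, is fixed by Frobenius and hence is a double root, and both sets are singletons.
theorem card_add_mul_add_card_trace_norm_le (h : Module.finrank E L = 2) (s p : E) :
    (Finset.univ.filter fun x : E × E => x.1 + x.2 = s ∧ x.1 * x.2 = p).card +
      (Finset.univ.filter fun z : L => Algebra.trace E L z = s ∧ Algebra.norm E z = p).card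
      ≤ 2 := by
  set A := Finset.univ.filter fun x : E × E => x.1 + x.2 = s ∧ x.1 * x.2 = p with hA
  set B := Finset.univ.filter fun z : L => Algebra.trace E L z = s ∧ Algebra.norm E z = p with hB
  have hinj := (algebraMap E L).injective
  have hz : ∀ z ∈ B, algebraMap E L s = z + z ^ Fintype.card E ∧
      algebraMap E L p = z * z ^ Fintype.card E := by
    intro z hz
    rw [hB, Finset.mem_filter] at hz
    rw [← hz.2.1, ← hz.2.2]
    exact ⟨algebraMap_trace_of_finrank_eq_two h z, algebraMap_norm_of_finrank_eq_two h z⟩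
  have key : ∀ x ∈ A, ∀ z ∈ B, x = (x.1, x.1) ∧ z = algebraMap E L x.1 := by
    rintro ⟨x, y⟩ hx z hz'
    obtain ⟨h1, h2⟩ := hz z hz'
    rw [hA, Finset.mem_filter] at hx
    obtain ⟨-, hs, hp⟩ := hx
    simp only at hs hp
    rw [← hs, map_add] at h1
    rw [← hp, map_mul] at h2
    have hprod : (z - algebraMap E L x) * (z - algebraMap E L y) = 0 := by
      linear_combination z * (-h1) + h2
    have hfrob : ∀ w : E, (algebraMap E L w) ^ Fintype.card E = algebraMap E L w := by
      intro w
      rw [← map_pow, FiniteField.pow_card]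
    rcases mul_eq_zero.mp hprod with h0 | h0
    · have hzx := sub_eq_zero.mp h0
      rw [hzx, hfrob] at h1
      have : y = x := hinj (by linear_combination h1)
      subst this
      exact ⟨rfl, hzx⟩
    · have hzx := sub_eq_zero.mp h0
      rw [hzx, hfrob] at h1
      have : x = y := hinj (by linear_combination h1)
      subst this
      exact ⟨rfl, hzx⟩
  have hA2 : A.card ≤ 2 := by
    rcases A.eq_empty_or_nonempty with h0 | ⟨⟨x, y⟩, hx⟩
    · simp [h0]
    · refine (Finset.card_le_card (t := {(x, y), (y, x)}) ?_).trans Finset.card_le_two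
      rintro ⟨x', y'⟩ hx'
      rw [hA, Finset.mem_filter] at hx hx'
      obtain ⟨-, h1, h2⟩ := hx
      obtain ⟨-, h3, h4⟩ := hx'
      simp only at h1 h2 h3 h4
      have hprod : (x' - x) * (x' - y) = 0 := by
        linear_combination x' * (h3 - h1) - h4 + h2
      simp only [Finset.mem_insert, Finset.mem_singleton, Prod.mk.injEq]
      rcases mul_eq_zero.mp hprod with h0 | h0
      · exact Or.inl ⟨sub_eq_zero.mp h0, by linear_combination h3 - h1 - h0⟩
      · exact Or.inr ⟨sub_eq_zero.mp h0, by linear_combination h3 - h1 - h0⟩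
  have hB2 : B.card ≤ 2 := by
    rcases B.eq_empty_or_nonempty with h0 | ⟨z, hz'⟩
    · simp [h0]
    · refine (Finset.card_le_card (t := {z, z ^ Fintype.card E}) ?_).trans Finset.card_le_two
      intro w hw
      obtain ⟨h1, h2⟩ := hz z hz'
      obtain ⟨h3, h4⟩ := hz w hw
      have hprod : (w - z) * (w - z ^ Fintype.card E) = 0 := by
        linear_combination w * (h1 - h3) + h4 - h2
      simp only [Finset.mem_insert, Finset.mem_singleton]
      exact (mul_eq_zero.mp hprod).imp sub_eq_zero.mp sub_eq_zero.mp
  rcases A.eq_empty_or_nonempty with h0 | ⟨x, hx⟩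
  · simpa [h0] using hB2
  rcases B.eq_empty_or_nonempty with h0 | ⟨z, hz'⟩
  · simpa [h0] using hA2
  have hA1 : A.card ≤ 1 := by
    refine Finset.card_le_one.mpr fun u hu v hv => ?_
    have h1 := key u hu z hz'
    have h2 := key v hv z hz'
    rw [h1.1, h2.1, hinj (h1.2.symm.trans h2.2)]
  have hB1 : B.card ≤ 1 :=
    Finset.card_le_one.mpr fun u hu v hv => (key x hx u hu).2.trans (key x hx v hv).2.symm
  omega

/-- The two fibres over `(s, p)` have together at most 2 elements, and over all `(s, p)` they have
`|E|² + |L| = 2|E|²`; so the bound is attained everywhere. No discriminant occurs, so characteristic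
two needs no separate treatment. -/
theorem sum_add_mul_add_sum_trace_norm (h : Module.finrank E L = 2) (φ : E → E → ℂ) :
    (∑ x : E, ∑ y : E, φ (x + y) (x * y)) +
      ∑ z : L, φ (Algebra.trace E L z) (Algebra.norm E z) = 2 * ∑ s : E, ∑ p : E, φ s p := by
  classical
  set A : E × E → Finset (E × E) := fun w =>
    Finset.univ.filter fun x : E × E => x.1 + x.2 = w.1 ∧ x.1 * x.2 = w.2 with hA
  set B : E × E → Finset L := fun w =>
    Finset.univ.filter fun z : L => Algebra.trace E L z = w.1 ∧ Algebra.norm E z = w.2 with hB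
  have hcardL : Fintype.card L = Fintype.card E ^ 2 := by
    rw [← h]; exact Module.card_eq_pow_finrank
  have hA1 : ∀ f : E × E → ℂ, ∑ x : E × E, f (x.1 + x.2, x.1 * x.2) =
      ∑ w : E × E, (A w).card * f w := by
    intro f
    rw [← Finset.sum_fiberwise (s := Finset.univ) (g := fun x : E × E => (x.1 + x.2, x.1 * x.2))]
    refine Finset.sum_congr rfl fun w _ => ?_
    rw [Finset.sum_congr rfl (g := fun _ => f w) (fun x hx => by
      rw [Finset.mem_filter] at hx; rw [hx.2])]
    simp [hA, Prod.ext_iff]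
  have hB1 : ∀ f : E × E → ℂ, ∑ z : L, f (Algebra.trace E L z, Algebra.norm E z) =
      ∑ w : E × E, (B w).card * f w := by
    intro f
    rw [← Finset.sum_fiberwise (s := Finset.univ)
      (g := fun z : L => (Algebra.trace E L z, Algebra.norm E z))]
    refine Finset.sum_congr rfl fun w _ => ?_
    rw [Finset.sum_congr rfl (g := fun _ => f w) (fun x hx => by
      rw [Finset.mem_filter] at hx; rw [hx.2])]
    simp [hB, Prod.ext_iff]
  have htotal : ∑ w : E × E, ((A w).card + (B w).card) = ∑ _w : E × E, 2 := by
    have h1 := hA1 fun _ => 1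
    have h2 := hB1 fun _ => 1
    simp only [Finset.sum_const, Finset.card_univ, nsmul_eq_mul, mul_one, Fintype.card_prod,
      hcardL] at h1 h2 ⊢
    rw [Finset.sum_add_distrib]
    have : ((∑ w : E × E, (A w).card + ∑ w : E × E, (B w).card : ℕ) : ℂ)
        = ((Fintype.card E * Fintype.card E * 2 : ℕ) : ℂ) := by
      push_cast at h1 h2 ⊢
      rw [← h1, ← h2]
      ring
    simpa using Nat.cast_injective this
  have heq := (Finset.sum_eq_sum_iff_of_le fun w _ =>
    card_add_mul_add_card_trace_norm_le h w.1 w.2).mp htotal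
  have h1 := hA1 fun w => φ w.1 w.2
  have h2 := hB1 fun w => φ w.1 w.2
  simp only [Fintype.sum_prod_type] at h1
  rw [h1, h2, ← Fintype.sum_prod_type' φ, Finset.mul_sum, ← Fintype.sum_prod_type'
    (fun x y => ((A (x, y)).card : ℂ) * φ x y), ← Finset.sum_add_distrib]
  refine Finset.sum_congr rfl fun w hw => ?_
  have := heq w hw
  rw [← add_mul, ← Nat.cast_add]
  change (((A w).card + (B w).card : ℕ) : ℂ) * _ = _
  rw [show (A w).card + (B w).card = 2 from this]
  norm_num

end QuadraticExtension

/-! ### Kloosterman sums and their behaviour in a quadratic extension. -/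

/-- The lift of an additive character along the trace. -/
noncomputable def AddChar.compTrace {E : Type*} [Field E] (L : Type*) [Field L] [Algebra E L]
    (ψ : AddChar E ℂ) :
    AddChar L ℂ :=
  ψ.compAddMonoidHom (Algebra.trace E L).toAddMonoidHom

theorem AddChar.compTrace_apply {E L : Type*} [Field E] [Field L] [Algebra E L] (ψ : AddChar E ℂ)
    (x : L) :
    ψ.compTrace L x = ψ (Algebra.trace E L x) := rfl

section Kloosterman

variable {E : Type*} [Field E] [Fintype E]

open Classical in
/-- The Kloosterman sum `∑_{x ≠ 0} ψ (x + a / x)`. -/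
noncomputable def kloosterman (ψ : AddChar E ℂ) (a : E) : ℂ :=
  ∑ x : E, if x = 0 then 0 else ψ (x + a / x)

/-- The substitution `x ↦ -x` negates `x + a / x`. Reality is what allows the sums to be estimated
from one side at a time. -/
theorem conj_kloosterman (ψ : AddChar E ℂ) (a : E) :
    (starRingEnd ℂ) (kloosterman ψ a) = kloosterman ψ a := by
  rw [kloosterman, map_sum, ← Equiv.sum_comp (Equiv.neg E)]
  refine Finset.sum_congr rfl fun x _ => ?_
  by_cases hx : x = 0
  · simp [hx]
  rw [Equiv.neg_apply, if_neg (neg_ne_zero.mpr hx), if_neg hx, ← AddChar.map_neg_eq_conj]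
  congr 1
  rw [div_neg]
  ring

theorem ofReal_re_kloosterman (ψ : AddChar E ℂ) (a : E) :
    ((kloosterman ψ a).re : ℂ) = kloosterman ψ a :=
  Complex.conj_eq_iff_re.mp (conj_kloosterman ψ a)

theorem AddChar.sum_mul_right_eq_ite {ψ : AddChar E ℂ} (hψ : ψ ≠ 1) [DecidableEq E] (b : E) :
    ∑ x : E, ψ (x * b) = if b = 0 then (Fintype.card E : ℂ) else 0 := by
  rw [AddChar.sum_mulShift b (AddChar.IsPrimitive.of_ne_one hψ)]
  split_ifs <;> simp

variable {L : Type*} [Field L] [Fintype L] [Algebra E L]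

theorem AddChar.compTrace_ne_one {ψ : AddChar E ℂ} (hψ : ψ ≠ 1) : ψ.compTrace L ≠ 1 := by
  obtain ⟨x, hx⟩ := AddChar.ne_one_iff.mp hψ
  obtain ⟨y, rfl⟩ := Algebra.trace_surjective E L x
  exact AddChar.ne_one_iff.mpr ⟨y, hx⟩

/-- Since `x + a/x + y + a/y = (x + y)(1 + a/(xy))`, the square is a sum over pairs of a function of
sum and product, and `K_L` is the sum over `L` of the same function of trace and norm. Together they
give twice the sum over all `(s, p)`, where summation over `s` leaves only `p = -a`. -/
theorem kloosterman_sq_add (h : Module.finrank E L = 2) {ψ : AddChar E ℂ} (hψ : ψ ≠ 1) {a : E}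
    (ha : a ≠ 0) :
    kloosterman ψ a ^ 2 + kloosterman (ψ.compTrace L) (algebraMap E L a) =
      2 * Fintype.card E := by
  classical
  have key := sum_add_mul_add_sum_trace_norm h
    fun s p => if p = 0 then 0 else ψ (s * (1 + a / p))
  have h1 : kloosterman ψ a ^ 2 = ∑ x : E, ∑ y : E,
      if x * y = 0 then 0 else ψ ((x + y) * (1 + a / (x * y))) := by
    rw [sq, kloosterman, Finset.sum_mul_sum]
    refine Finset.sum_congr rfl fun x _ => Finset.sum_congr rfl fun y _ => ?_
    by_cases hx : x = 0
    · simp [hx]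
    by_cases hy : y = 0
    · simp [hy]
    simp only [hx, hy, mul_eq_zero, or_self, if_false]
    rw [← AddChar.map_add_eq_mul]
    congr 1
    field_simp
    ring
  have h2 : kloosterman (ψ.compTrace L) (algebraMap E L a) = ∑ z : L,
      if Algebra.norm E z = 0 then 0
        else ψ (Algebra.trace E L z * (1 + a / Algebra.norm E z)) := by
    rw [kloosterman]
    refine Finset.sum_congr rfl fun z _ => ?_
    by_cases hz : z = 0
    · simp [hz]
    have hn : Algebra.norm E z ≠ 0 := Algebra.norm_ne_zero_iff.mpr hz
    rw [if_neg hz, if_neg hn, AddChar.compTrace_apply]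
    congr 1
    have hzN : z ^ Fintype.card E ≠ 0 := pow_ne_zero _ hz
    have hfrob : ∀ w : E, (algebraMap E L w) ^ Fintype.card E = algebraMap E L w := by
      intro w
      rw [← map_pow, FiniteField.pow_card]
    apply (algebraMap E L).injective
    rw [algebraMap_trace_of_finrank_eq_two h, map_mul, map_add, map_div₀, map_one,
      algebraMap_trace_of_finrank_eq_two h, algebraMap_norm_of_finrank_eq_two h]
    have hadd : (z + algebraMap E L a / z) ^ Fintype.card E =
        z ^ Fintype.card E + algebraMap E L a / z ^ Fintype.card E := by
      obtain ⟨p, hp⟩ := CharP.exists E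
      obtain ⟨n, hpp, hn⟩ := FiniteField.card E p
      have := Fact.mk hpp
      have : CharP L p := charP_of_injective_algebraMap (algebraMap E L).injective p
      rw [hn, add_pow_char_pow, div_pow, ← hn, hfrob]
    rw [hadd]
    field_simp
    ring
  rw [h1, h2]
  rw [key]
  congr 1
  rw [Finset.sum_comm]
  have : ∀ p : E, ∑ s : E, (if p = 0 then 0 else ψ (s * (1 + a / p))) =
      if p = -a then (Fintype.card E : ℂ) else 0 := by
    intro p
    by_cases hp : p = 0
    · have : (0 : E) ≠ -a := by simpa [eq_comm] using ha
      simp [hp, this]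
    · simp only [hp, if_false]
      rw [AddChar.sum_mul_right_eq_ite hψ]
      have : 1 + a / p = 0 ↔ p = -a := by
        rw [add_comm, ← neg_eq_iff_add_eq_zero, ← neg_div, div_eq_one_iff_eq hp, eq_comm]
      simp [this]
  simp_rw [this]
  simp

end Kloosterman

/-! ### Stepanov's method. -/

section Stepanov

open Polynomial

theorem Polynomial.exists_ne_zero_sum_C_mul_eq_zero {K ι : Type*} [Field K] [Fintype ι]
    (T : ι → K[X]) (D : ℕ) (hT : ∀ i, (T i).natDegree < D) (h : D < Fintype.card ι) :
    ∃ c : ι → K, c ≠ 0 ∧ ∑ i, C (c i) * T i = 0 := by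
  let Φ : (ι → K) →ₗ[K] (Fin D → K) :=
    LinearMap.pi fun k => (lcoeff K k).comp (Fintype.linearCombination K T)
  have hker : LinearMap.ker Φ ≠ ⊥ := LinearMap.ker_ne_bot_of_finrank_lt (by simpa using h)
  obtain ⟨c, hc, hc0⟩ := (Submodule.ne_bot_iff _).mp hker
  refine ⟨c, hc0, ?_⟩
  ext k
  rw [coeff_zero]
  by_cases hk : k < D
  · have := congrFun (LinearMap.mem_ker.mp hc) ⟨k, hk⟩
    simpa [Φ, Fintype.linearCombination_apply, finsetSum_coeff, smul_eq_C_mul] using this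
  · rw [finsetSum_coeff]
    refine Finset.sum_eq_zero fun i _ => ?_
    rw [coeff_C_mul, coeff_eq_zero_of_natDegree_lt ((hT i).trans_le (not_lt.mp hk)), mul_zero]

/-- Among the terms with nonzero coefficient, the one of largest degree cannot be cancelled. -/
theorem Polynomial.sum_C_mul_ne_zero_of_natDegree_injective {K ι : Type*} [Field K] [Fintype ι]
    (P : ι → K[X]) (hP : ∀ i, P i ≠ 0) (hinj : Function.Injective fun i => (P i).natDegree)
    (c : ι → K) (hc : c ≠ 0) : ∑ i, C (c i) * P i ≠ 0 := by
  classical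
  obtain ⟨i₁, hi₁⟩ := Function.ne_iff.mp hc
  obtain ⟨i₀, hi₀, hmax⟩ := Finset.exists_max_image (Finset.univ.filter fun i => c i ≠ 0)
    (fun i => (P i).natDegree) ⟨i₁, by simpa using hi₁⟩
  intro h0
  have h := congrArg (fun p => coeff p (P i₀).natDegree) h0
  simp only [finsetSum_coeff, coeff_C_mul, coeff_zero] at h
  rw [Finset.sum_eq_single i₀] at h
  · rcases mul_eq_zero.mp h with h | h
    · exact (Finset.mem_filter.mp hi₀).2 h
    · exact hP i₀ (leadingCoeff_eq_zero.mp h)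
  · intro i _ hi
    by_cases hci : c i = 0
    · simp [hci]
    · rw [coeff_eq_zero_of_natDegree_lt, mul_zero]
      exact lt_of_le_of_ne (hmax i (by simpa using hci)) fun h => hi (hinj h)
  · simp

/-- Mixed-radix digits, with bases `ρ` and `q`; this separates the degrees of the auxiliary
polynomials. -/
theorem digits_injective (ρ B q a : ℕ) :
    Function.Injective fun v : Fin ρ × Fin B × Fin q =>
      (v.1 : ℕ) + q * ρ * v.2.1 + ρ * v.2.2 + a := by
  rintro ⟨i, j, l⟩ ⟨i', j', l'⟩ h
  simp only at h
  have e : (i : ℕ) + ρ * (l + q * j) = i' + ρ * (l' + q * j') := by linarith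
  have h1 : (i : ℕ) = i' := by
    have := congrArg (· % ρ) e
    simpa [Nat.add_mul_mod_self_left, Nat.mod_eq_of_lt i.2, Nat.mod_eq_of_lt i'.2] using this
  have hρ : 0 < ρ := i.pos
  have h2 : (l : ℕ) + q * j = l' + q * j' := by
    rw [h1] at e
    exact Nat.eq_of_mul_eq_mul_left hρ (Nat.add_left_cancel e)
  have h3 : (l : ℕ) = l' := by
    have := congrArg (· % q) h2
    simpa [Nat.add_mul_mod_self_left, Nat.mod_eq_of_lt l.2, Nat.mod_eq_of_lt l'.2] using this
  have hq : 0 < q := l.pos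
  have h4 : (j : ℕ) = j' := by
    rw [h3] at h2
    exact Nat.eq_of_mul_eq_mul_left hq (Nat.add_left_cancel h2)
  exact Prod.ext (Fin.ext h1) (Prod.ext (Fin.ext h4) (Fin.ext h3))

variable {E : Type*} [Field E]

/-- The polynomial `x ^ (q ^ m) * ∑_{i ≤ m} (x + t / x) ^ (q ^ i)`. -/
noncomputable def halfTracePoly (q m : ℕ) (t : E) : E[X] :=
  ∑ i ∈ Finset.range (m + 1),
    (X ^ (q ^ m + q ^ i) + C (t ^ q ^ i) * X ^ (q ^ m - q ^ i))

theorem natDegree_halfTracePoly {q : ℕ} (hq : 1 < q) (m : ℕ) (t : E) :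
    (halfTracePoly q m t).natDegree = 2 * q ^ m := by
  have hpos : 0 < q ^ m := pow_pos (by omega) m
  rw [halfTracePoly, Finset.sum_range_succ, Nat.sub_self, pow_zero, mul_one, ← add_assoc,
    natDegree_add_C, natDegree_add_eq_right_of_natDegree_lt]
  · rw [natDegree_X_pow, two_mul]
  · rw [natDegree_X_pow]
    refine Nat.lt_of_le_pred (by omega) (natDegree_sum_le_of_forall_le _ _ fun i hi => ?_)
    have hlt : q ^ i < q ^ m := Nat.pow_lt_pow_right hq (Finset.mem_range.mp hi)
    refine (natDegree_add_le _ _).trans (max_le ?_ ?_)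
    · rw [natDegree_X_pow]
      simp only [Nat.pred_eq_sub_one]
      omega
    · refine (natDegree_C_mul_le _ _).trans ?_
      rw [natDegree_X_pow]
      simp only [Nat.pred_eq_sub_one]
      omega

theorem halfTracePoly_ne_zero {q : ℕ} (hq : 1 < q) (m : ℕ) (t : E) :
    halfTracePoly q m t ≠ 0 := by
  intro h
  have := natDegree_halfTracePoly hq m t
  rw [h, natDegree_zero] at this
  have hpos : 0 < q ^ m := pow_pos (by omega) m
  omega

variable {F : Type*} [Field F] [Fintype F] [Algebra F E]

theorem eval_halfTracePoly (m : ℕ) (t : E) {x : E} (hx : x ≠ 0) :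
    (halfTracePoly (Fintype.card F) m t).eval x = x ^ (Fintype.card F ^ m) *
      ∑ i ∈ Finset.range (m + 1), (x + t / x) ^ (Fintype.card F ^ i) := by
  rw [halfTracePoly, eval_finsetSum, Finset.mul_sum]
  refine Finset.sum_congr rfl fun i hi => ?_
  have hle : Fintype.card F ^ i ≤ Fintype.card F ^ m :=
    Nat.pow_le_pow_right Fintype.card_pos (Nat.lt_succ_iff.mp (Finset.mem_range.mp hi))
  have hadd : (x + t / x) ^ (Fintype.card F ^ i) =
      x ^ (Fintype.card F ^ i) + (t / x) ^ (Fintype.card F ^ i) := by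
    obtain ⟨p, hp⟩ := CharP.exists F
    obtain ⟨n, hpp, hn⟩ := FiniteField.card F p
    have := Fact.mk hpp
    have : CharP E p := charP_of_injective_algebraMap (algebraMap F E).injective p
    rw [hn, ← pow_mul, add_pow_char_pow]
  rw [hadd]
  simp only [eval_add, eval_pow, eval_X, eval_mul, eval_C]
  rw [div_pow, mul_add, ← pow_add, pow_sub₀ x hx hle]
  field_simp

theorem sum_pow_card_pow {ι : Type*} (s : Finset ι) (f : ι → E) (m : ℕ) :
    (∑ i ∈ s, f i) ^ (Fintype.card F ^ m) = ∑ i ∈ s, f i ^ (Fintype.card F ^ m) := by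
  obtain ⟨p, hp⟩ := CharP.exists F
  obtain ⟨n, hpp, hn⟩ := FiniteField.card F p
  have := Fact.mk hpp
  have : CharP E p := charP_of_injective_algebraMap (algebraMap F E).injective p
  rw [hn, ← pow_mul, sum_pow_char_pow]

variable [Fintype E]

open Classical in
/-- Stepanov's bound for the curve `y ^ q - y = x + t / x`. -/
theorem card_trace_add_div_eq_le (m : ℕ) (hE : Module.finrank F E = 2 * (m + 1)) (t : E) (s : F) :
    (Finset.univ.filter fun x : E => x ≠ 0 ∧ Algebra.trace F E (x + t / x) = s).card ≤
      Fintype.card F ^ (m + 1) * (Fintype.card F ^ m + 8) := by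
  set q := Fintype.card F with hq
  have hq1 : 1 < q := Fintype.one_lt_card
  set ρ := q ^ m with hρ
  have hρ0 : 0 < ρ := pow_pos (by omega) m
  have hr : q ^ (m + 1) = q * ρ := by rw [pow_succ, mul_comm]
  have hcard : Fintype.card E = (q ^ (m + 1)) ^ 2 := by
    rw [← pow_mul, mul_comm (m + 1) 2, ← hE]
    exact Module.card_eq_pow_finrank
  set r := q ^ (m + 1) with hrdef
  have h2ρ : 2 * ρ ≤ r := by rw [hr]; exact Nat.mul_le_mul_right _ hq1
  set G := halfTracePoly q m t with hG
  have hGdeg : G.natDegree = 2 * ρ := natDegree_halfTracePoly hq1 m t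
  have hG0 : G ≠ 0 := halfTracePoly_ne_zero hq1 m t
  -- With `(i, j, l) = v` and `g` the half trace of `x + t / x`, the value at `x` is `x^(ρ(q-1)) *
  -- x^(i+rj) * g^l`; the last power of `X` makes the first factor independent of `l`.
  let P : Fin ρ × Fin (ρ + 6) × Fin q → E[X] := fun v =>
    X ^ (v.1 + r * v.2.1 : ℕ) * G ^ (v.2.2 : ℕ) * X ^ (ρ * (q - 1 - v.2.2))
  -- Up to powers of `x`, this is the `r`-th power of `P v` on the solution set: there `g^r = s -
  -- g`, and `x^(r²) = x` turns the exponent `i + rj` into `ri + j`. The degree therefore stays near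
  -- `rρ`.
  let T : Fin ρ × Fin (ρ + 6) × Fin q → E[X] := fun v =>
    X ^ (r * v.1 + v.2.1 : ℕ) * (C (algebraMap F E s) * X ^ ρ - G) ^ (v.2.2 : ℕ) *
      X ^ (ρ * (q - 1 - v.2.2))
  have hexp : ∀ l : Fin q, ρ * (q - 1 - l) + ρ * l = ρ * (q - 1) := by
    intro l
    rw [← mul_add, Nat.sub_add_cancel (Nat.le_sub_one_of_lt l.2)]
  have hρq : ρ * (q - 1) + ρ = r := by
    rw [hr, ← Nat.mul_succ, Nat.succ_eq_add_one, Nat.sub_add_cancel hq1.le, mul_comm]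
  have hPdeg : ∀ v, (P v).natDegree = v.1 + q * ρ * v.2.1 + ρ * v.2.2 + ρ * (q - 1) := by
    intro v
    have h1 := hexp v.2.2
    rw [natDegree_mul (mul_ne_zero (pow_ne_zero _ X_ne_zero) (pow_ne_zero _ hG0))
      (pow_ne_zero _ X_ne_zero), natDegree_mul (pow_ne_zero _ X_ne_zero) (pow_ne_zero _ hG0),
      natDegree_X_pow, natDegree_X_pow, natDegree_pow, hGdeg, ← hr, ← h1]
    ring
  have hP0 : ∀ v, P v ≠ 0 := fun v =>
    mul_ne_zero (mul_ne_zero (pow_ne_zero _ X_ne_zero) (pow_ne_zero _ hG0))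
      (pow_ne_zero _ X_ne_zero)
  have hPinj : Function.Injective fun v => (P v).natDegree := by
    simp_rw [hPdeg]
    exact digits_injective ρ (ρ + 6) q _
  have hTdeg : ∀ v, (T v).natDegree < r * ρ + r + (ρ + 6) := by
    intro v
    have h1 := hexp v.2.2
    have h2 : ρ * v.2.2 ≤ ρ * (q - 1) := by omega
    have h3 : (C (algebraMap F E s) * X ^ ρ - G).natDegree ≤ 2 * ρ := by
      refine (natDegree_sub_le _ _).trans (max_le ?_ hGdeg.le)
      exact (natDegree_C_mul_le _ _).trans (by rw [natDegree_X_pow]; omega)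
    have h4 : (T v).natDegree ≤
        (r * v.1 + v.2.1) + v.2.2 * (2 * ρ) + ρ * (q - 1 - v.2.2) := by
      refine natDegree_mul_le.trans (add_le_add (natDegree_mul_le.trans (add_le_add ?_ ?_)) ?_)
      · rw [natDegree_X_pow]
      · exact natDegree_pow_le.trans (Nat.mul_le_mul_left _ h3)
      · rw [natDegree_X_pow]
    have h5 : r * v.1 + r ≤ r * ρ := by
      rw [← Nat.mul_succ]
      exact Nat.mul_le_mul_left _ v.1.2
    have h6 := v.2.1.2
    have h7 : (v.2.2 : ℕ) * (2 * ρ) = ρ * v.2.2 + ρ * v.2.2 := by ring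
    omega
  -- There are `rρ + 6r` unknowns; the 6 in `Fin (ρ + 6)` makes them outnumber the coefficients to
  -- be killed.
  have hdim : r * ρ + r + (ρ + 6) < Fintype.card (Fin ρ × Fin (ρ + 6) × Fin q) := by
    simp only [Fintype.card_prod, Fintype.card_fin]
    have : ρ * ((ρ + 6) * q) = r * ρ + 6 * r := by rw [hr]; ring
    omega
  obtain ⟨c', hc'0, hc'⟩ := exists_ne_zero_sum_C_mul_eq_zero T _ hTdeg hdim
  have hrr : ∀ x : E, (x ^ r) ^ r = x := by
    intro x
    rw [← pow_mul, ← sq, ← hcard, FiniteField.pow_card]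
  -- Taking `r`-th powers twice is the identity on `E`, so the `r`-th power of `W` has the
  -- coefficients `c'`.
  set c : Fin ρ × Fin (ρ + 6) × Fin q → E := fun v => c' v ^ r with hc
  have hc0 : c ≠ 0 := by
    intro h
    apply hc'0
    funext v
    have := congrFun h v
    exact pow_eq_zero_iff (by omega) |>.mp this
  set W := ∑ v, C (c v) * P v with hW
  have hW0 : W ≠ 0 := sum_C_mul_ne_zero_of_natDegree_injective P hP0 hPinj c hc0
  have hWdeg : W.natDegree ≤ r * (ρ + 8) := by
    refine natDegree_sum_le_of_forall_le _ _ fun v _ => (natDegree_C_mul_le _ _).trans ?_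
    rw [hPdeg, ← hr]
    have h1 := hexp v.2.2
    have h2 : r * v.2.1 + r ≤ r * (ρ + 6) := by
      rw [← Nat.mul_succ]
      exact Nat.mul_le_mul_left _ v.2.1.2
    have h3 := v.1.2
    have h4 : r * (ρ + 8) = r * (ρ + 6) + 2 * r := by ring
    omega
  -- Simple zeros suffice: the degree bound `r(ρ + 8)` exceeds the average fibre size, about `|E|/q
  -- = rρ`, only by a multiple of `r`.
  refine (Finset.card_le_card (t := W.roots.toFinset) fun x hx => ?_).trans
    ((Multiset.toFinset_card_le _).trans ((card_roots' W).trans hWdeg))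
  obtain ⟨-, hx0, hxs⟩ := Finset.mem_filter.mp hx
  rw [Multiset.mem_toFinset, mem_roots hW0, IsRoot.def]
  set g : E := ∑ i ∈ Finset.range (m + 1), (x + t / x) ^ (q ^ i) with hg
  have hGx : G.eval x = x ^ ρ * g := eval_halfTracePoly m t hx0
  have hgr : g ^ r = algebraMap F E s - g := by
    rw [← hxs, FiniteField.algebraMap_trace_eq_sum_pow, hE, two_mul, Finset.sum_range_add,
      Nat.card_eq_fintype_card, ← hq, ← hg, add_sub_cancel_left, hg, hrdef, hq,
      sum_pow_card_pow (F := F)]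
    refine Finset.sum_congr rfl fun i _ => ?_
    rw [← pow_mul, ← pow_add, add_comm i]
  have hTx : ∑ v, c' v * (T v).eval x = 0 := by
    have := congrArg (eval x) hc'
    simpa [eval_finsetSum] using this
  have hterm : ∀ v, x ^ (ρ * (q - 1)) * (c v * (P v).eval x) ^ r =
      x ^ (r * (ρ * (q - 1))) * (c' v * (T v).eval x) := by
    intro v
    have h1 := hexp v.2.2
    simp only [P, T, eval_mul, eval_pow, eval_X, eval_sub, eval_C, hGx]
    have e1 : algebraMap F E s * x ^ ρ - x ^ ρ * g = x ^ ρ * g ^ r := by rw [hgr]; ring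
    have e2 : (x ^ (v.1 + r * v.2.1 : ℕ)) ^ r = x ^ (r * v.1 + v.2.1 : ℕ) := by
      rw [pow_add, mul_pow, pow_add, pow_mul x r v.2.1, pow_mul x r v.1,
        pow_right_comm x v.1 r, pow_right_comm (x ^ r) v.2.1 r, hrr]
    have e3 : (c v) ^ r = c' v := hrr (c' v)
    rw [e1, mul_pow, mul_pow, mul_pow, e2, e3, ← h1]
    simp only [mul_pow, ← pow_mul, mul_add, pow_add]
    ring
  have hzero : x ^ (ρ * (q - 1)) * (W.eval x) ^ r = 0 := by
    rw [hW, eval_finsetSum, show (∑ v, eval x (C (c v) * P v)) ^ r =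
      ∑ v, (eval x (C (c v) * P v)) ^ r from sum_pow_card_pow (F := F) _ _ _, Finset.mul_sum]
    simp only [eval_mul, eval_C]
    rw [Finset.sum_congr rfl fun v _ => by simpa only [eval_mul, eval_C] using hterm v,
      ← Finset.mul_sum, hTx, mul_zero]
  rcases mul_eq_zero.mp hzero with h | h
  · exact absurd h (pow_ne_zero _ hx0)
  · exact pow_eq_zero_iff (by omega) |>.mp h

end Stepanov

/-! ### Weil's bound for Kloosterman sums. -/

section WeilBound

theorem AddChar.compTrace_compTrace {F E L : Type*} [Field F] [Field E] [Field L] [Algebra F E]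
    [Algebra E L] [Algebra F L] [IsScalarTower F E L] [Module.Finite F E] [Module.Finite E L]
    (ψ : AddChar F ℂ) :
    (ψ.compTrace E).compTrace L = ψ.compTrace L := by
  ext x
  rw [AddChar.compTrace_apply, AddChar.compTrace_apply, AddChar.compTrace_apply,
    Algebra.trace_trace]

/-- `L` lies in `Type` whatever the universe of `E`, so the tower can be handled by an induction
over fields in `Type`. -/
theorem FiniteField.exists_quadratic_extension (F E : Type*) [Field F] [Field E] [Finite E]
    [Algebra F E] : ∃ (L : Type) (_ : Field L) (_ : Fintype L) (_ : Algebra E L) (_ : Algebra F L),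
      IsScalarTower F E L ∧ Module.finrank E L = 2 := by
  obtain ⟨p, hp⟩ := CharP.exists E
  have : Fact p.Prime := ⟨CharP.char_is_prime E p⟩
  let alg : Algebra F (FiniteField.Extension E p 2) :=
    ((algebraMap E (FiniteField.Extension E p 2)).comp (algebraMap F E)).toAlgebra
  exact ⟨FiniteField.Extension E p 2, inferInstance, Fintype.ofFinite _, inferInstance, alg,
    IsScalarTower.of_algebraMap_eq fun _ => rfl, FiniteField.finrank_extension E p 2⟩

theorem kloosterman_compTrace_mulShift_zero {F E : Type*} [Field F] [Field E] [Fintype E]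
    [Algebra F E] (ψ : AddChar F ℂ) (t : E) :
    kloosterman ((ψ.mulShift 0).compTrace E) t = Fintype.card E - 1 := by
  classical
  have : ∀ x : E, (if x = 0 then 0 else (ψ.mulShift 0).compTrace E (x + t / x)) =
      1 - if x = 0 then (1 : ℂ) else 0 := by
    intro x
    by_cases hx : x = 0 <;> simp [hx, AddChar.compTrace_apply]
  rw [kloosterman, Finset.sum_congr rfl fun x _ => this x]
  simp

variable {F E : Type*} [Field F] [Fintype F] [Field E] [Fintype E] [Algebra F E]

open Classical in
theorem sum_kloosterman_mulShift {ψ : AddChar F ℂ} (hψ : ψ ≠ 1) (t : E) :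
    ∑ c : F, kloosterman ((ψ.mulShift c).compTrace E) t = Fintype.card F *
      (Finset.univ.filter fun x : E => x ≠ 0 ∧ Algebra.trace F E (x + t / x) = 0).card := by
  simp_rw [kloosterman]
  rw [Finset.sum_comm, Finset.card_filter, Nat.cast_sum, Finset.mul_sum]
  refine Finset.sum_congr rfl fun x _ => ?_
  by_cases hx : x = 0
  · simp [hx]
  simp only [hx, if_false, AddChar.compTrace_apply, AddChar.mulShift_apply,
    AddChar.sum_mul_right_eq_ite hψ, ne_eq, not_false_eq_true, true_and]
  split_ifs <;> simp

open Classical in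
-- Stepanov's upper bound for the `q - 1` nonzero trace values, subtracted from the total `|E| - 1`.
theorem card_trace_add_div_eq_zero_ge (m : ℕ) (hE : Module.finrank F E = 2 * (m + 1)) (t : E) :
    (Fintype.card E : ℝ) - 1 - ((Fintype.card F : ℝ) - 1) *
        ((Fintype.card F : ℝ) ^ (m + 1) * ((Fintype.card F : ℝ) ^ m + 8)) ≤
      (Finset.univ.filter fun x : E => x ≠ 0 ∧ Algebra.trace F E (x + t / x) = 0).card := by
  set A : F → Finset E := fun s =>
    Finset.univ.filter fun x : E => x ≠ 0 ∧ Algebra.trace F E (x + t / x) = s with hA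
  have h1 : ∑ s : F, (A s).card = Fintype.card E - 1 := by
    have h2 := Finset.card_eq_sum_card_fiberwise (s := Finset.univ.filter fun x : E => x ≠ 0)
      (t := Finset.univ) (f := fun x => Algebra.trace F E (x + t / x)) (by simp)
    simp only [Finset.filter_filter] at h2
    rw [← h2, Finset.filter_ne', Finset.card_erase_of_mem (Finset.mem_univ _), Finset.card_univ]
  have h2 : ∑ s ∈ Finset.univ.erase (0 : F), (A s).card ≤
      (Fintype.card F - 1) * (Fintype.card F ^ (m + 1) * (Fintype.card F ^ m + 8)) := by
    refine (Finset.sum_le_card_nsmul _ _ _ fun s _ => card_trace_add_div_eq_le m hE t s).trans ?_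
    rw [Finset.card_erase_of_mem (Finset.mem_univ _), Finset.card_univ, smul_eq_mul]
  rw [← Finset.add_sum_erase _ _ (Finset.mem_univ (0 : F))] at h1
  have h3 : (((A 0).card + ∑ s ∈ Finset.univ.erase (0 : F), (A s).card : ℕ) : ℝ) =
      Fintype.card E - 1 := by
    rw [h1, Nat.cast_sub Fintype.card_pos, Nat.cast_one]
  have h4 : ((∑ s ∈ Finset.univ.erase (0 : F), (A s).card : ℕ) : ℝ) ≤
      ((Fintype.card F : ℝ) - 1) *
        ((Fintype.card F : ℝ) ^ (m + 1) * ((Fintype.card F : ℝ) ^ m + 8)) := by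
    have := (Nat.cast_le (α := ℝ)).mpr h2
    rw [Nat.cast_mul, Nat.cast_sub Fintype.card_pos] at this
    exact_mod_cast this
  rw [Nat.cast_add] at h3
  change _ ≤ ((A 0).card : ℝ)
  linarith

variable {L : Type*} [Field L] [Fintype L] [Algebra E L] [Algebra F L] [IsScalarTower F E L]

theorem re_kloosterman_sq_add (h : Module.finrank E L = 2) {ψ : AddChar F ℂ} (hψ : ψ ≠ 1) {a : E}
    (ha : a ≠ 0) :
    (kloosterman (ψ.compTrace E) a).re ^ 2 +
      (kloosterman (ψ.compTrace L) (algebraMap E L a)).re = 2 * Fintype.card E := by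
  have key := kloosterman_sq_add h (AddChar.compTrace_ne_one (L := E) hψ) ha
  rw [AddChar.compTrace_compTrace, ← ofReal_re_kloosterman (ψ.compTrace E),
    ← ofReal_re_kloosterman (ψ.compTrace L)] at key
  exact_mod_cast key

/-- The sums for all multiples `ψ(c ·)` add up to `q` times the number of solutions of trace zero.
The term `c = 0` is `|L| - 1`, and every `c ≠ 0` contributes at most `2|E|` by
`re_kloosterman_sq_add`. Since the solution count is bounded below, the term `c = 1` cannot be very
negative; the terms of order `|L|` cancel. -/
theorem re_kloosterman_quadratic_ge (h : Module.finrank E L = 2) {ψ : AddChar F ℂ} (hψ : ψ ≠ 1)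
    {a : E} (ha : a ≠ 0) :
    -((8 * (Fintype.card F : ℝ) ^ 2 + 2 * Fintype.card F) * Fintype.card E) ≤
      (kloosterman (ψ.compTrace L) (algebraMap E L a)).re := by
  classical
  obtain ⟨m, hm⟩ : ∃ m, Module.finrank F E = m + 1 :=
    Nat.exists_eq_add_one.mpr Module.finrank_pos
  have hL : Module.finrank F L = 2 * (m + 1) := by
    rw [← Module.finrank_mul_finrank F E L, h, hm, mul_comm]
  have hcE : (Fintype.card E : ℝ) = (Fintype.card F : ℝ) ^ (m + 1) := by
    rw [← hm]; exact_mod_cast Module.card_eq_pow_finrank (K := F) (V := E)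
  have hcL : (Fintype.card L : ℝ) = ((Fintype.card F : ℝ) ^ (m + 1)) ^ 2 := by
    rw [← pow_mul, mul_comm (m + 1) 2, ← hL]
    exact_mod_cast Module.card_eq_pow_finrank (K := F) (V := L)
  set t := algebraMap E L a
  set k : F → ℝ := fun c => (kloosterman ((ψ.mulShift c).compTrace L) t).re with hk
  have hsum : ∑ c, k c = Fintype.card F *
      (Finset.univ.filter fun x : L => x ≠ 0 ∧ Algebra.trace F L (x + t / x) = 0).card := by
    have := congrArg Complex.re (sum_kloosterman_mulShift hψ t)
    rw [Complex.re_sum] at this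
    rw [hk, this]
    norm_cast
  have h0 : k 0 = Fintype.card L - 1 := by
    rw [hk]
    simp only [kloosterman_compTrace_mulShift_zero]
    simp
  have hlow := card_trace_add_div_eq_zero_ge m hL t
  have hup : ∀ c : F, c ≠ 0 → k c ≤ 2 * Fintype.card E := by
    intro c hc
    have := re_kloosterman_sq_add h (ψ := ψ.mulShift c) (AddChar.IsPrimitive.of_ne_one hψ hc) ha
    have h2 := sq_nonneg (kloosterman ((ψ.mulShift c).compTrace E) a).re
    simp only [hk]
    linarith
  have hsplit : ∑ c, k c = k 0 + (k 1 + ∑ c ∈ (Finset.univ.erase (0 : F)).erase 1, k c) := by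
    rw [Finset.add_sum_erase _ _ (by simp), Finset.add_sum_erase _ _ (Finset.mem_univ _)]
  have hrest : ∑ c ∈ (Finset.univ.erase (0 : F)).erase 1, k c ≤
      (Fintype.card F : ℝ) * (2 * Fintype.card E) := by
    refine (Finset.sum_le_card_nsmul _ _ (2 * (Fintype.card E : ℝ)) fun c hc => hup c ?_).trans ?_
    · exact Finset.ne_of_mem_erase (Finset.mem_of_mem_erase hc)
    · rw [nsmul_eq_mul]
      gcongr
      exact Finset.card_le_univ _
  have hk1 : k 1 = (kloosterman (ψ.compTrace L) t).re := by
    simp [hk]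
  rw [← hk1]
  rw [hcL] at h0 hlow
  rw [hcE] at hrest ⊢
  have hq : (1 : ℝ) ≤ Fintype.card F := by exact_mod_cast Fintype.card_pos
  set q : ℝ := (Fintype.card F : ℝ)
  have hr1 : (1 : ℝ) ≤ q ^ (m + 1) := one_le_pow₀ hq
  have hmul := mul_le_mul_of_nonneg_left hlow (by linarith : (0 : ℝ) ≤ q)
  rw [← hsum, hsplit, h0] at hmul
  set r := q ^ (m + 1) with hr
  have hrq : r = q * q ^ m := by rw [hr, pow_succ, mul_comm]
  have e : q * (r ^ 2 - 1 - (q - 1) * (r * (q ^ m + 8))) =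
      q * r ^ 2 - q - (q - 1) * r * r - 8 * q * (q - 1) * r := by
    rw [show (q : ℝ) * (r ^ 2 - 1 - (q - 1) * (r * (q ^ m + 8))) =
      q * r ^ 2 - q - (q - 1) * r * (q * q ^ m) - 8 * q * (q - 1) * r by ring, ← hrq]
  rw [e] at hmul
  nlinarith [mul_le_mul hq hr1 zero_le_one (by linarith)]

/-- `K² = 2|E| - K_L ≤ (4 + δ)|E| ≤ (2 + δ/4)²|E|`. -/
theorem abs_re_kloosterman_le_of_quadratic (h : Module.finrank E L = 2) {ψ : AddChar F ℂ}
    (hψ : ψ ≠ 1) {a : E} (ha : a ≠ 0) {δ : ℝ} (hδ : 0 ≤ δ)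
    (hL : |(kloosterman (ψ.compTrace L) (algebraMap E L a)).re| ≤
      (2 + δ) * √(Fintype.card L : ℝ)) :
    |(kloosterman (ψ.compTrace E) a).re| ≤ (2 + δ / 4) * √(Fintype.card E : ℝ) := by
  have hcL : (Fintype.card L : ℝ) = (Fintype.card E : ℝ) ^ 2 := by
    rw [← h]; exact_mod_cast Module.card_eq_pow_finrank (K := E) (V := L)
  rw [hcL, Real.sqrt_sq (Nat.cast_nonneg _)] at hL
  have key := re_kloosterman_sq_add (L := L) h hψ ha
  have h1 := (abs_le.mp hL).1
  have hs : √(Fintype.card E : ℝ) ^ 2 = Fintype.card E := Real.sq_sqrt (Nat.cast_nonneg _)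
  have h0 : (0 : ℝ) ≤ Fintype.card E := Nat.cast_nonneg _
  refine abs_le_of_sq_le_sq ?_ (by positivity)
  rw [mul_pow, hs]
  nlinarith [mul_nonneg (sq_nonneg δ) h0]

/-- The start of the iteration: the constant is crude but depends only on `F`, so it serves every
field of the tower. -/
theorem abs_re_kloosterman_le_of_card_field {ψ : AddChar F ℂ} (hψ : ψ ≠ 1) {a : E} (ha : a ≠ 0) :
    |(kloosterman (ψ.compTrace E) a).re| ≤
      (2 + (8 * (Fintype.card F : ℝ) ^ 2 + 2 * Fintype.card F)) * √(Fintype.card E : ℝ) := by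
  obtain ⟨L, _, _, _, _, _, h⟩ := FiniteField.exists_quadratic_extension F E
  have key := re_kloosterman_sq_add (L := L) h hψ ha
  have h1 := re_kloosterman_quadratic_ge (L := L) h hψ ha
  have hs : √(Fintype.card E : ℝ) ^ 2 = Fintype.card E := Real.sq_sqrt (Nat.cast_nonneg _)
  have h0 : (0 : ℝ) ≤ Fintype.card E := Nat.cast_nonneg _
  set C : ℝ := 8 * (Fintype.card F : ℝ) ^ 2 + 2 * Fintype.card F with hC
  have hC0 : 0 ≤ C := by positivity
  refine abs_le_of_sq_le_sq ?_ (by positivity)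
  rw [mul_pow, hs]
  nlinarith [mul_nonneg (sq_nonneg C) h0, mul_nonneg hC0 h0]

theorem abs_re_kloosterman_le_iterate {ψ : AddChar F ℂ} (hψ : ψ ≠ 1) (j : ℕ) :
    ∀ (K : Type) [Field K] [Fintype K] [Algebra F K] (a : K), a ≠ 0 →
      |(kloosterman (ψ.compTrace K) a).re| ≤
        (2 + (8 * (Fintype.card F : ℝ) ^ 2 + 2 * Fintype.card F) / 4 ^ j) *
          √(Fintype.card K : ℝ) := by
  induction j with
  | zero =>
    intro K _ _ _ a ha
    simpa using abs_re_kloosterman_le_of_card_field hψ ha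
  | succ j ih =>
    intro K _ _ _ a ha
    obtain ⟨L, _, _, _, _, _, h⟩ := FiniteField.exists_quadratic_extension F K
    rw [pow_succ 4 j, ← div_div]
    exact abs_re_kloosterman_le_of_quadratic h hψ ha (by positivity)
      (ih L _ ((map_ne_zero _).mpr ha))

/-- Weil's bound for Kloosterman sums. -/
theorem abs_re_kloosterman_le {ψ : AddChar F ℂ} (hψ : ψ ≠ 1) {a : E} (ha : a ≠ 0) :
    |(kloosterman (ψ.compTrace E) a).re| ≤ 2 * √(Fintype.card E : ℝ) := by
  obtain ⟨L, _, _, _, _, _, h⟩ := FiniteField.exists_quadratic_extension F E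
  have hL : |(kloosterman (ψ.compTrace L) (algebraMap E L a)).re| ≤
      (2 + 0) * √(Fintype.card L : ℝ) := by
    refine ge_of_tendsto' (x := Filter.atTop)
      (Filter.Tendsto.mul_const _ (Filter.Tendsto.const_add 2 ?_))
      fun j => abs_re_kloosterman_le_iterate hψ j L _ ((map_ne_zero _).mpr ha)
    exact tendsto_const_nhds.div_atTop (tendsto_pow_atTop_atTop_of_one_lt (by norm_num))
  -- The limit was taken for `L`, which lies in `Type`; one more descent, with `δ = 0`, reaches `E`
  -- in its own universe.
  simpa using abs_re_kloosterman_le_of_quadratic h hψ ha le_rfl hL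

end WeilBound

/-! ### Quadratic forms with the Gauss sums of an elliptic form. -/

section GaussSum

open QuadraticMap

open Classical in
theorem AddChar.sum_linearMap_eq_ite {F M : Type*} [Field F] [AddCommGroup M] [Module F M]
    [Fintype M] {ψ : AddChar F ℂ} (hψ : ψ ≠ 1) (f : M →ₗ[F] F) :
    ∑ x : M, ψ (f x) = if f = 0 then (Fintype.card M : ℂ) else 0 := by
  have h := AddChar.sum_eq_ite (ψ.compAddMonoidHom f.toAddMonoidHom)
  have hiff : ψ.compAddMonoidHom f.toAddMonoidHom = 0 ↔ f = 0 := by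
    constructor
    · intro h0
      by_contra hf
      obtain ⟨x, hx⟩ := DFunLike.ne_iff.mp hf
      obtain ⟨c, hc⟩ := AddChar.ne_one_iff.mp hψ
      have := DFunLike.congr_fun h0 ((c * (f x)⁻¹) • x)
      apply hc
      simpa [inv_mul_cancel_right₀ hx] using this
    · rintro rfl
      ext x
      simp
  simp only [hiff] at h
  exact h

/-- Completing the square in a quadratic exponential sum. -/
theorem sum_addChar_mul_add_polar {F V : Type*} [Field F] [AddCommGroup V] [Module F V]
    [Fintype V] (Q : QuadraticForm F V) (ψ : AddChar F ℂ) {c : F} (hc : c ≠ 0) (u : V) :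
    ∑ w, ψ (c * Q w + polar Q u w) = ψ (-(Q u / c)) * ∑ w, ψ (c * Q w) := by
  rw [← Equiv.sum_comp (Equiv.addRight (c⁻¹ • u)) fun w => ψ (c * Q w), Finset.mul_sum]
  refine Finset.sum_congr rfl fun w _ => ?_
  rw [← AddChar.map_add_eq_mul, Equiv.coe_addRight, QuadraticMap.map_add Q, polar_smul_right,
    QuadraticMap.map_smul, polar_comm Q w u, smul_eq_mul, smul_eq_mul]
  congr 1
  field_simp
  ring

/-- The quadratic form `Q` has the exponential sums of a nondegenerate form of minus type in
dimension `2 * n + 2`. -/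
def HasEllipticGaussSums {F V : Type*} [Field F] [Fintype F] [AddCommGroup V] [Module F V]
    [Fintype V] (Q : QuadraticForm F V) (ψ : AddChar F ℂ) (n : ℕ) : Prop :=
  Fintype.card V = Fintype.card F ^ (2 * n + 2) ∧
    ∀ c : F, c ≠ 0 → ∑ w, ψ (c * Q w) = -(Fintype.card F : ℂ) ^ (n + 1)

variable {F V : Type*} [Field F] [Fintype F] [AddCommGroup V] [Module F V] [Fintype V]
  {Q : QuadraticForm F V} {ψ : AddChar F ℂ} {n : ℕ}

/-- Translation by a vector `u` of the radical multiplies the nonzero Gauss sum by `ψ (-(Q u / c))`,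
and if `Q u ≠ 0` some `c` makes this factor differ from 1. The content is in characteristic two,
where the polar form does not determine `Q`. -/
theorem HasEllipticGaussSums.map_eq_zero (hQ : HasEllipticGaussSums Q ψ n) (hψ : ψ ≠ 1) {u : V}
    (hu : Q.polarBilin u = 0) : Q u = 0 := by
  by_contra h0
  obtain ⟨d, hd⟩ := AddChar.ne_one_iff.mp hψ
  have hd0 : d ≠ 0 := by
    rintro rfl
    simp at hd
  set c := -(Q u / d) with hc
  have hc0 : c ≠ 0 := neg_ne_zero.mpr (div_ne_zero h0 hd0)
  have h := sum_addChar_mul_add_polar Q ψ hc0 u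
  have hp : ∀ w, polar Q u w = 0 := fun w => DFunLike.congr_fun hu w
  simp only [hp, add_zero] at h
  have hval : -(Q u / c) = d := by
    rw [hc]
    field_simp
  have hG : ∑ w, ψ (c * Q w) ≠ 0 := by
    rw [hQ.2 c hc0]
    exact neg_ne_zero.mpr (pow_ne_zero _ (Nat.cast_ne_zero.mpr Fintype.card_ne_zero))
  rw [hval] at h
  exact hd (mul_right_cancel₀ hG (by rw [one_mul]; exact h.symm))

/-- The squared modulus of the Gauss sum is `|V|` by hypothesis and `|V|` times the size of the
radical by direct expansion. -/
theorem HasEllipticGaussSums.polarBilin_ne_zero (hQ : HasEllipticGaussSums Q ψ n) (hψ : ψ ≠ 1)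
    {u : V} (hu : u ≠ 0) : Q.polarBilin u ≠ 0 := by
  classical
  have hV : (Fintype.card V : ℂ) = (Fintype.card F : ℂ) ^ (2 * n + 2) := by
    exact_mod_cast hQ.1
  have h1 := hQ.2 1 one_ne_zero
  simp only [one_mul] at h1
  have h2 : (∑ w, ψ (Q w)) * (starRingEnd ℂ) (∑ w, ψ (Q w)) = Fintype.card V := by
    rw [h1, hV]
    simp only [map_neg, map_pow, map_natCast]
    ring
  have h3 : (∑ w, ψ (Q w)) * (starRingEnd ℂ) (∑ w, ψ (Q w)) =
      Fintype.card V * (Finset.univ.filter fun u : V => Q.polarBilin u = 0).card := by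
    rw [map_sum, Finset.sum_mul_sum, Finset.sum_comm]
    have : ∀ w', ∑ w, ψ (Q w) * (starRingEnd ℂ) (ψ (Q w')) =
        ∑ u, ψ (Q u) * ψ (Q.polarBilin u w') := by
      intro w'
      rw [← Equiv.sum_comp (Equiv.addRight w')]
      refine Finset.sum_congr rfl fun w _ => ?_
      rw [← AddChar.map_neg_eq_conj, ← AddChar.map_add_eq_mul, ← AddChar.map_add_eq_mul,
        Equiv.coe_addRight, QuadraticMap.map_add Q, polarBilin_apply_apply]
      congr 1
      ring
    rw [Finset.sum_congr rfl fun w' _ => this w', Finset.sum_comm, Finset.card_filter,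
      Nat.cast_sum, Finset.mul_sum]
    refine Finset.sum_congr rfl fun u _ => ?_
    rw [← Finset.mul_sum, AddChar.sum_linearMap_eq_ite hψ]
    split_ifs with h
    · simp [hQ.map_eq_zero hψ h]
    · simp
  have h4 : (Finset.univ.filter fun u : V => Q.polarBilin u = 0).card = 1 := by
    have h5 : (Fintype.card V : ℂ) ≠ 0 := Nat.cast_ne_zero.mpr Fintype.card_ne_zero
    have := h3.symm.trans h2
    exact_mod_cast mul_left_cancel₀ h5 (this.trans (mul_one _).symm)
  intro h
  obtain ⟨v, hv⟩ := Finset.card_eq_one.mp h4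
  have e0 : (0 : V) ∈ Finset.univ.filter fun u : V => Q.polarBilin u = 0 := by simp
  have e1 : u ∈ Finset.univ.filter fun u : V => Q.polarBilin u = 0 := by simpa using h
  rw [hv, Finset.mem_singleton] at e0 e1
  exact hu (e1.trans e0.symm)

open Classical in
theorem HasEllipticGaussSums.sum_polar (hQ : HasEllipticGaussSums Q ψ n) (hψ : ψ ≠ 1) (u : V) :
    ∑ w, ψ (polar Q u w) = if u = 0 then (Fintype.card V : ℂ) else 0 := by
  have h := AddChar.sum_linearMap_eq_ite hψ (Q.polarBilin u)
  simp only [polarBilin_apply_apply] at h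
  rw [h]
  by_cases hu : u = 0
  · simp [hu]
  · rw [if_neg hu, if_neg (hQ.polarBilin_ne_zero hψ hu)]

open Classical in
/-- The number of singular vectors orthogonal to a totally singular subspace. -/
theorem HasEllipticGaussSums.card_singular_perp (hQ : HasEllipticGaussSums Q ψ n) (hψ : ψ ≠ 1)
    {U : Submodule F V} (hU : TotallySingular Q U) {j a : ℕ} (hj : Module.finrank F U = j)
    (hn : j + a = n) :
    ((Finset.univ.filter fun w : V => Q w = 0 ∧ ∀ u ∈ U, polar Q u w = 0).card : ℝ) =
      (Fintype.card F : ℝ) ^ (n + 1 + a) - ((Fintype.card F : ℝ) - 1) * (Fintype.card F : ℝ) ^ n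
    := by
  set q := Fintype.card F with hq
  have hcU : Fintype.card U = q ^ j := by rw [← hj]; exact Module.card_eq_pow_finrank
  set s := (Finset.univ.filter fun w : V => Q w = 0 ∧ ∀ u ∈ U, polar Q u w = 0).card with hs
  -- The sum over `c` detects `Q w = 0`, the sum over `u` detects orthogonality to `U`.
  have h1 : ∑ c : F, ∑ u : U, ∑ w : V, ψ (c * Q w + polar Q u w) = (q : ℂ) * q ^ j * s := by
    have : ∀ c : F, ∑ u : U, ∑ w : V, ψ (c * Q w + polar Q u w) =
        ∑ w : V, ψ (c * Q w) * ∑ u : U, ψ (polar Q u w) := by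
      intro c
      rw [Finset.sum_comm]
      refine Finset.sum_congr rfl fun w _ => ?_
      rw [Finset.mul_sum]
      exact Finset.sum_congr rfl fun u _ => AddChar.map_add_eq_mul _ _ _
    rw [Finset.sum_congr rfl fun c _ => this c, Finset.sum_comm, hs, Finset.card_filter,
      Nat.cast_sum, Finset.mul_sum]
    refine Finset.sum_congr rfl fun w _ => ?_
    rw [← Finset.sum_mul, AddChar.sum_mul_right_eq_ite hψ]
    have h2 := AddChar.sum_linearMap_eq_ite hψ ((Q.polarBilin.flip w).comp U.subtype)
    simp only [LinearMap.comp_apply, LinearMap.flip_apply, polarBilin_apply_apply,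
      Submodule.subtype_apply, hcU] at h2
    rw [h2]
    have h3 : (Q.polarBilin.flip w).comp U.subtype = 0 ↔ ∀ u ∈ U, polar Q u w = 0 := by
      rw [LinearMap.ext_iff]
      simp
    simp only [h3]
    by_cases h4 : Q w = 0 <;> by_cases h5 : ∀ u ∈ U, polar Q u w = 0 <;>
      simp [h4, h5, hq]
  -- For `c = 0` only `u = 0` survives. For `c ≠ 0` completing the square gives the Gauss sum
  -- without a phase, because `Q u = 0`.
  have h2 : ∑ c : F, ∑ u : U, ∑ w : V, ψ (c * Q w + polar Q u w) =
      (q : ℂ) ^ (2 * n + 2) - (q - 1) * (q ^ j * q ^ (n + 1)) := by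
    rw [← Finset.add_sum_erase _ _ (Finset.mem_univ (0 : F))]
    have e0 : ∑ u : U, ∑ w : V, ψ (0 * Q w + polar Q u w) = (q : ℂ) ^ (2 * n + 2) := by
      simp only [zero_mul, zero_add, hQ.sum_polar hψ, ZeroMemClass.coe_eq_zero]
      simp [hQ.1, hq]
    have e1 : ∀ c ∈ Finset.univ.erase (0 : F), ∑ u : U, ∑ w : V, ψ (c * Q w + polar Q u w) =
        -((q : ℂ) ^ j * q ^ (n + 1)) := by
      intro c hc
      have hc0 := Finset.ne_of_mem_erase hc
      have : ∀ u : U, ∑ w : V, ψ (c * Q w + polar Q u w) = -(q : ℂ) ^ (n + 1) := by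
        intro u
        rw [sum_addChar_mul_add_polar Q ψ hc0, hU u u.2, hQ.2 c hc0]
        simp [hq]
      rw [Finset.sum_congr rfl fun u _ => this u, Finset.sum_const, Finset.card_univ, hcU]
      simp
    rw [e0, Finset.sum_congr rfl e1, Finset.sum_const, Finset.card_erase_of_mem (Finset.mem_univ _),
      Finset.card_univ, nsmul_eq_mul, Nat.cast_sub Fintype.card_pos, Nat.cast_one]
    ring
  have h3 : (q : ℝ) * q ^ j * s = (q : ℝ) ^ (2 * n + 2) - (q - 1) * (q ^ j * q ^ (n + 1)) := by
    exact_mod_cast h1.symm.trans h2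
  have hq0 : (q : ℝ) ≠ 0 := Nat.cast_ne_zero.mpr Fintype.card_ne_zero
  have hqj : (q : ℝ) * q ^ j ≠ 0 := mul_ne_zero hq0 (pow_ne_zero _ hq0)
  refine mul_left_cancel₀ hqj (h3.trans ?_)
  subst hn
  ring

end GaussSum

/-! ### Sets that meet all generators equally, by double counting. -/

section Ovoid

open QuadraticMap

theorem TotallySingular.polar_eq_zero {F V : Type*} [Field F] [AddCommGroup V] [Module F V]
    {Q : QuadraticForm F V} {U : Submodule F V} (hU : TotallySingular Q U) {u v : V} (hu : u ∈ U)
    (hv : v ∈ U) : polar Q u v = 0 := by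
  rw [polar, hU _ (U.add_mem hu hv), hU _ hu, hU _ hv]
  ring

theorem TotallySingular.sup_span_singleton {F V : Type*} [Field F] [AddCommGroup V] [Module F V]
    {Q : QuadraticForm F V} {U : Submodule F V} (hU : TotallySingular Q U) {y : V} (hy : Q y = 0)
    (hp : ∀ u ∈ U, polar Q u y = 0) : TotallySingular Q (U ⊔ Submodule.span F {y}) := by
  intro w hw
  obtain ⟨u, hu, z, hz, rfl⟩ := Submodule.mem_sup.mp hw
  obtain ⟨c, rfl⟩ := Submodule.mem_span_singleton.mp hz
  rw [QuadraticMap.map_add Q, QuadraticMap.map_smul, polar_smul_right, hU u hu, hy, hp u hu]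
  simp

theorem polar_sup_span_singleton_eq_zero_iff {F V : Type*} [Field F] [AddCommGroup V] [Module F V]
    {Q : QuadraticForm F V} {U : Submodule F V} {y x : V} :
    (∀ u ∈ U ⊔ Submodule.span F {y}, polar Q u x = 0) ↔
      (∀ u ∈ U, polar Q u x = 0) ∧ polar Q y x = 0 := by
  constructor
  · intro h
    exact ⟨fun u hu => h u (Submodule.mem_sup_left hu),
      h y (Submodule.mem_sup_right (Submodule.mem_span_singleton_self y))⟩
  · rintro ⟨h1, h2⟩ w hw
    obtain ⟨u, hu, z, hz, rfl⟩ := Submodule.mem_sup.mp hw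
    obtain ⟨c, rfl⟩ := Submodule.mem_span_singleton.mp hz
    rw [polar_add_left, polar_smul_left, h1 u hu, h2]
    simp

theorem Submodule.mem_sup_span_singleton_exchange {F V : Type*} [Field F] [AddCommGroup V]
    [Module F V] {U : Submodule F V} {x y : V} (hx : x ∉ U)
    (h : x ∈ U ⊔ Submodule.span F {y}) : y ∈ U ⊔ Submodule.span F {x} := by
  obtain ⟨u, hu, z, hz, rfl⟩ := Submodule.mem_sup.mp h
  obtain ⟨c, rfl⟩ := Submodule.mem_span_singleton.mp hz
  have hc : c ≠ 0 := by
    rintro rfl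
    simp [hu] at hx
  have h1 : c⁻¹ • ((u + c • y) - u) = y := by
    rw [add_sub_cancel_left, smul_smul, inv_mul_cancel₀ hc, one_smul]
  have h2 : c⁻¹ • ((u + c • y) - u) ∈ U ⊔ Submodule.span F {u + c • y} :=
    Submodule.smul_mem _ _ (Submodule.sub_mem _
      (Submodule.mem_sup_right (Submodule.mem_span_singleton_self _)) (Submodule.mem_sup_left hu))
  rwa [h1] at h2

variable {F V : Type*} [Field F] [Fintype F] [AddCommGroup V] [Module F V] [Fintype V]
  {Q : QuadraticForm F V} {ψ : AddChar F ℂ} {n : ℕ}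

open Classical in
/-- A set `X` of singular vectors that meets all generators in `μ` vectors satisfies
`|X ∩ U^⊥| - μ = q ^ (a + 1) * (μ - |X ∩ U|)` for each totally singular `U` of codimension `a` in
a generator. -/
theorem HasEllipticGaussSums.card_inter_perp_sub (hQ : HasEllipticGaussSums Q ψ n) (hψ : ψ ≠ 1)
    (X : Finset V) (hX : ∀ x ∈ X, Q x = 0) (μ : ℕ)
    (hμ : ∀ W, IsGenerator Q W → (X.filter (· ∈ W)).card = μ) (a : ℕ) :
    ∀ (j : ℕ) (U : Submodule F V), TotallySingular Q U → Module.finrank F U = j → j + a = n →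
      ((X.filter fun x => ∀ u ∈ U, polar Q u x = 0).card : ℝ) - μ =
        (Fintype.card F : ℝ) ^ (a + 1) * (μ - (X.filter (· ∈ U)).card) := by
  have hcU : ∀ (U : Submodule F V) (j : ℕ), Module.finrank F U = j →
      (Finset.univ.filter (· ∈ U)).card = Fintype.card F ^ j := by
    intro U j hj
    rw [← hj, ← Module.card_eq_pow_finrank (K := F) (V := U), Fintype.card_subtype]
  induction a with
  | zero =>
    intro j U hU hj hn
    have hs := hQ.card_singular_perp hψ hU hj hn
    have hsub : (Finset.univ.filter (· ∈ U)) ⊆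
        Finset.univ.filter fun w : V => Q w = 0 ∧ ∀ u ∈ U, polar Q u w = 0 := by
      intro w hw
      simp only [Finset.mem_filter, Finset.mem_univ, true_and] at hw ⊢
      exact ⟨hU w hw, fun u hu => hU.polar_eq_zero hu hw⟩
    -- For `a = 0` there are `q ^ n = |U|` singular vectors orthogonal to `U`, so they all lie in
    -- `U` and `U` is a generator.
    have heq := Finset.eq_of_subset_of_card_le hsub (by
      rw [hcU U j hj, ← Nat.cast_le (α := ℝ), hs]
      push_cast
      rw [← hn]
      apply le_of_eq
      ring)
    have hmem : ∀ w, Q w = 0 → (∀ u ∈ U, polar Q u w = 0) → w ∈ U := by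
      intro w h1 h2
      have : w ∈ Finset.univ.filter fun w : V => Q w = 0 ∧ ∀ u ∈ U, polar Q u w = 0 := by
        simpa using ⟨h1, h2⟩
      rw [← heq] at this
      simpa using this
    have hgen : IsGenerator Q U := ⟨hU, fun W hW hUW w hw =>
      hmem w (hW w hw) fun u hu => TotallySingular.polar_eq_zero hW (hUW hu) hw⟩
    have hf : (X.filter fun x => ∀ u ∈ U, polar Q u x = 0) = X.filter (· ∈ U) :=
      Finset.filter_congr fun x hx =>
        ⟨fun h => hmem x (hX x hx) h, fun h u hu => hU.polar_eq_zero hu h⟩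
    rw [hf, hμ U hgen]
    ring
  | succ a ih =>
    intro j U hU hj hn
    set q : ℝ := (Fintype.card F : ℝ) with hq
    have hq1 : 1 < q := by rw [hq]; exact_mod_cast Fintype.one_lt_card (α := F)
    -- The induction hypothesis for `U + ⟨y⟩` is summed over the singular `y` in `U^⊥` outside `U`.
    -- Both sides depend only on `|X ∩ U|` and `|X ∩ U^⊥|`, which gives one linear equation between
    -- them.
    set D : Finset V := Finset.univ.filter fun y =>
      (Q y = 0 ∧ ∀ u ∈ U, polar Q u y = 0) ∧ y ∉ U with hD
    have hDmem : ∀ y, y ∈ D ↔ (Q y = 0 ∧ ∀ u ∈ U, polar Q u y = 0) ∧ y ∉ U := by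
      intro y; simp [hD]
    have hDcard : (D.card : ℝ) + q ^ j = q ^ (n + 1 + (a + 1)) - (q - 1) * q ^ n := by
      have h := Finset.card_filter_add_card_filter_not
        (s := Finset.univ.filter fun y : V => Q y = 0 ∧ ∀ u ∈ U, polar Q u y = 0) (· ∈ U)
      rw [Finset.filter_filter, Finset.filter_filter] at h
      have : (Finset.univ.filter fun y : V => (Q y = 0 ∧ ∀ u ∈ U, polar Q u y = 0) ∧ y ∈ U) =
          Finset.univ.filter (· ∈ U) := by
        refine Finset.filter_congr fun y _ => ⟨fun h => h.2, fun h => ⟨⟨hU y h, fun u hu =>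
          hU.polar_eq_zero hu h⟩, h⟩⟩
      rw [this, hcU U j hj] at h
      rw [← hQ.card_singular_perp hψ hU hj hn, ← h]
      push_cast
      rw [add_comm]
    set U' : V → Submodule F V := fun y => U ⊔ Submodule.span F {y} with hU'
    have hU'ts : ∀ y ∈ D, TotallySingular Q (U' y) := fun y hy =>
      hU.sup_span_singleton ((hDmem y).mp hy).1.1 ((hDmem y).mp hy).1.2
    have hU'rank : ∀ y ∈ D, Module.finrank F (U' y) = j + 1 := fun y hy => by
      rw [hU', Submodule.finrank_sup_span_singleton ((hDmem y).mp hy).2, hj]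
    set G := X.filter fun x => ∀ u ∈ U, polar Q u x = 0 with hG
    have hGD : ∀ x ∈ G, x ∉ U → x ∈ D := fun x hx hxU =>
      (hDmem x).mpr ⟨⟨hX x (Finset.mem_filter.mp hx).1, (Finset.mem_filter.mp hx).2⟩, hxU⟩
    have hGU : G.filter (· ∈ U) = X.filter (· ∈ U) := by
      rw [hG, Finset.filter_filter]
      exact Finset.filter_congr fun x _ => ⟨fun h => h.2, fun h => ⟨fun u hu =>
        hU.polar_eq_zero hu h, h⟩⟩
    have hsplit : ∀ (f : V → ℝ) (A B : ℝ), (∀ x ∈ G, x ∈ U → f x = A) →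
        (∀ x ∈ G, x ∉ U → f x = B) → ∑ x ∈ G, f x =
          A * (X.filter (· ∈ U)).card + B * (G.card - (X.filter (· ∈ U)).card) := by
      intro f A B hA hB
      have hc := Finset.card_filter_add_card_filter_not (s := G) (· ∈ U)
      rw [hGU] at hc
      rw [← Finset.sum_filter_add_sum_filter_not G (· ∈ U),
        Finset.sum_congr rfl fun x hx =>
          hA x (Finset.mem_filter.mp hx).1 (Finset.mem_filter.mp hx).2,
        Finset.sum_congr rfl fun x hx =>
          hB x (Finset.mem_filter.mp hx).1 (Finset.mem_filter.mp hx).2,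
        Finset.sum_const, Finset.sum_const, hGU, ← hc]
      simp only [nsmul_eq_mul]
      push_cast
      ring
    have hg : ∑ y ∈ D, ((X.filter fun x => ∀ u ∈ U' y, polar Q u x = 0).card : ℝ) =
        D.card * (X.filter (· ∈ U)).card +
          (q ^ (n + 1 + a) - (q - 1) * q ^ n - q ^ j) * (G.card - (X.filter (· ∈ U)).card) := by
      have e : ∀ y ∈ D, ((X.filter fun x => ∀ u ∈ U' y, polar Q u x = 0).card : ℝ) =
          ∑ x ∈ G, if polar Q y x = 0 then (1 : ℝ) else 0 := by
        intro y _
        rw [hG, Finset.sum_boole, Finset.filter_filter]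
        simp_rw [hU', polar_sup_span_singleton_eq_zero_iff]
      rw [Finset.sum_congr rfl e, Finset.sum_comm]
      apply hsplit
      · intro x _ hxU
        rw [Finset.sum_congr rfl fun y hy => if_pos (by
          rw [polar_comm]; exact ((hDmem y).mp hy).1.2 x hxU)]
        simp
      · intro x hx hxU
        have hxD := hGD x hx hxU
        have hs := hQ.card_singular_perp hψ (hU'ts x hxD) (hU'rank x hxD)
          (a := a) (by omega)
        rw [← hq] at hs
        have h := Finset.card_filter_add_card_filter_not
          (s := Finset.univ.filter fun y : V => Q y = 0 ∧ ∀ u ∈ U' x, polar Q u y = 0) (· ∈ U)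
        rw [Finset.filter_filter, Finset.filter_filter] at h
        have e1 : (Finset.univ.filter fun y : V =>
            (Q y = 0 ∧ ∀ u ∈ U' x, polar Q u y = 0) ∧ y ∈ U) = Finset.univ.filter (· ∈ U) := by
          refine Finset.filter_congr fun y _ => ⟨fun h => h.2, fun h => ⟨⟨hU y h, ?_⟩, h⟩⟩
          rw [hU', polar_sup_span_singleton_eq_zero_iff]
          refine ⟨fun u hu => hU.polar_eq_zero hu h, ?_⟩
          rw [polar_comm]
          exact ((hDmem x).mp hxD).1.2 y h
        have e2 : (Finset.univ.filter fun y : V =>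
            ((Q y = 0 ∧ ∀ u ∈ U, polar Q u y = 0) ∧ y ∉ U) ∧ polar Q y x = 0) =
            Finset.univ.filter fun y : V =>
              (Q y = 0 ∧ ∀ u ∈ U' x, polar Q u y = 0) ∧ y ∉ U := by
          refine Finset.filter_congr fun y _ => ?_
          rw [hU', polar_sup_span_singleton_eq_zero_iff, polar_comm Q x y]
          tauto
        rw [e1, hcU U j hj] at h
        rw [Finset.sum_boole, ← hs, ← h, hD, Finset.filter_filter, e2]
        push_cast
        ring
    have he : ∑ y ∈ D, ((X.filter (· ∈ U' y)).card : ℝ) =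
        D.card * (X.filter (· ∈ U)).card +
          (q ^ (j + 1) - q ^ j) * (G.card - (X.filter (· ∈ U)).card) := by
      have e : ∀ y ∈ D, ((X.filter (· ∈ U' y)).card : ℝ) =
          ∑ x ∈ G, if x ∈ U' y then (1 : ℝ) else 0 := by
        intro y hy
        rw [hG, Finset.sum_boole, Finset.filter_filter]
        congr 2
        refine Finset.filter_congr fun x _ => ⟨fun h => ⟨fun u hu => ?_, h⟩, fun h => h.2⟩
        exact (hU'ts y hy).polar_eq_zero (Submodule.mem_sup_left hu) h
      rw [Finset.sum_congr rfl e, Finset.sum_comm]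
      apply hsplit
      · intro x _ hxU
        rw [Finset.sum_congr rfl fun y _ => if_pos (Submodule.mem_sup_left hxU)]
        simp
      · intro x hx hxU
        have hxD := hGD x hx hxU
        have hc := hcU (U' x) (j + 1) (hU'rank x hxD)
        rw [← Finset.card_filter_add_card_filter_not (· ∈ U), Finset.filter_filter,
          Finset.filter_filter] at hc
        have e1 : (Finset.univ.filter fun y : V => y ∈ U' x ∧ y ∈ U) =
            Finset.univ.filter (· ∈ U) :=
          Finset.filter_congr fun y _ => ⟨fun h => h.2, fun h => ⟨Submodule.mem_sup_left h, h⟩⟩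
        -- For `x` and `y` outside `U`, `x ∈ U + ⟨y⟩` exactly when `y ∈ U + ⟨x⟩`.
        have e2 : D.filter (fun y => x ∈ U' y) =
            Finset.univ.filter fun y : V => y ∈ U' x ∧ y ∉ U := by
          ext y
          simp only [Finset.mem_filter, Finset.mem_univ, true_and]
          constructor
          · rintro ⟨h1, h2⟩
            exact ⟨Submodule.mem_sup_span_singleton_exchange hxU h2, ((hDmem y).mp h1).2⟩
          · rintro ⟨h1, h2⟩
            refine ⟨(hDmem y).mpr ⟨⟨hU'ts x hxD y h1, fun u hu => ?_⟩, h2⟩,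
              Submodule.mem_sup_span_singleton_exchange h2 h1⟩
            exact (hU'ts x hxD).polar_eq_zero (Submodule.mem_sup_left hu) h1
        rw [e1, hcU U j hj, ← e2] at hc
        have hc' : (Fintype.card F : ℝ) ^ j + ((D.filter fun y => x ∈ U' y).card : ℝ) =
            (Fintype.card F : ℝ) ^ (j + 1) := by exact_mod_cast hc
        rw [Finset.sum_boole, hq, ← hc']
        ring
    have hih : ∑ y ∈ D, (((X.filter fun x => ∀ u ∈ U' y, polar Q u x = 0).card : ℝ) - μ) =
        ∑ y ∈ D, q ^ (a + 1) * (μ - (X.filter (· ∈ U' y)).card) :=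
      Finset.sum_congr rfl fun y hy => ih (j + 1) (U' y) (hU'ts y hy) (hU'rank y hy) (by omega)
    rw [Finset.sum_sub_distrib, ← Finset.mul_sum, Finset.sum_sub_distrib, hg, he,
      Finset.sum_const, nsmul_eq_mul] at hih
    set e : ℝ := ((X.filter (· ∈ U)).card : ℝ)
    set g : ℝ := (G.card : ℝ)
    set S : ℝ := (D.card : ℝ)
    have hS : S = q ^ (n + 1 + (a + 1)) - (q - 1) * q ^ n - q ^ j := by linarith
    have hqj : q ^ j ≠ 0 := pow_ne_zero _ (by linarith)
    have hqa : 1 < q ^ (a + 1) := one_lt_pow₀ hq1 (by omega)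
    have hne : q ^ j * (q ^ (a + 1) * q ^ (a + 1) - 1) ≠ 0 :=
      mul_ne_zero hqj (by nlinarith)
    have hzero : q ^ j * (q ^ (a + 1) * q ^ (a + 1) - 1) *
        (g - μ - q ^ (a + 1 + 1) * (μ - e)) = 0 := by
      rw [hS, ← hn] at hih
      ring_nf at hih ⊢
      linarith
    have := (mul_eq_zero.mp hzero).resolve_left hne
    linarith

end Ovoid

/-! ### Exponential sums of the elliptic form. -/

section EllipticForm

open QuadraticMap Polynomial

theorem ellipticForm_zero_apply {E : Type*} [Field E] (a₀ a₁ x w : E) :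
    ellipticForm E 0 a₀ a₁ ![x, w] = x ^ 2 + a₀ * x * w + a₁ * w ^ 2 := by
  rw [ellipticForm_apply]
  simp

theorem ellipticForm_succ_apply {E : Type*} [Field E] (k : ℕ) (a₀ a₁ x z : E)
    (w : Fin (2 * k + 2) → E) :
    ellipticForm E (k + 1) a₀ a₁ (Fin.cons x (Fin.cons z w : Fin (2 * k + 2 + 1) → E)) =
      x * z + ellipticForm E k a₀ a₁ w := by
  rw [ellipticForm_apply, ellipticForm_apply, Fin.sum_univ_succ]
  have h : ∀ A B C D G : E, A + B + C + D + G = A + (B + C + D + G) := by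
    intros
    ring
  exact h _ _ _ _ _

theorem polar_traceForm {F E V' : Type*} [Field F] [Field E] [Algebra F E]
    [AddCommGroup V'] [Module E V'] [Module F V'] [IsScalarTower F E V']
    (Q' : QuadraticForm E V') (v w : V') :
    polar (traceForm F Q') v w = Algebra.trace F E (polar Q' v w) := by
  simp [polar, traceForm_apply]

variable {E : Type*} [Field E] [Fintype E]

theorem norm_sub_mul_of_trace_norm {L : Type*} [Field L] [Fintype L] [Algebra E L]
    (h : Module.finrank E L = 2) {a₀ a₁ : E} {θ : L} (htr : Algebra.trace E L θ = -a₀)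
    (hn : Algebra.norm E θ = a₁) (x w : E) :
    Algebra.norm E (algebraMap E L x - algebraMap E L w * θ) =
      x ^ 2 + a₀ * x * w + a₁ * w ^ 2 := by
  have hfrob : ∀ w : E, (algebraMap E L w) ^ Fintype.card E = algebraMap E L w := by
    intro w
    rw [← map_pow, FiniteField.pow_card]
  have h1 := algebraMap_trace_of_finrank_eq_two h θ
  have h2 := algebraMap_norm_of_finrank_eq_two h θ
  have h3 : (algebraMap E L x - algebraMap E L w * θ) ^ Fintype.card E =
      algebraMap E L x - algebraMap E L w * θ ^ Fintype.card E := by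
    obtain ⟨p, hp⟩ := CharP.exists E
    obtain ⟨n, hpp, hn⟩ := FiniteField.card E p
    have := Fact.mk hpp
    have : CharP L p := charP_of_injective_algebraMap (algebraMap E L).injective p
    have h4 := hfrob x
    have h5 := hfrob w
    rw [hn] at h4 h5 ⊢
    rw [sub_pow_char_pow, mul_pow, h4, h5]
  apply (algebraMap E L).injective
  rw [algebraMap_norm_of_finrank_eq_two h, h3]
  rw [htr, map_neg] at h1
  rw [hn] at h2
  simp only [map_add, map_mul, map_pow]
  linear_combination (-algebraMap E L w * algebraMap E L x) * (-h1) - (algebraMap E L w) ^ 2 * h2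

/-- The form is the norm of `x - wθ` for a root `θ` in the quadratic extension. By
`sum_add_mul_add_sum_trace_norm` its sum and that of the hyperbolic form `xz`, which is `|E|`, add
up to zero. -/
theorem sum_addChar_anisotropic {a₀ a₁ : E}
    (hirr : Irreducible (X ^ 2 + C a₀ * X + C a₁ : E[X])) {ψ : AddChar E ℂ} (hψ : ψ ≠ 1) {y : E}
    (hy : y ≠ 0) :
    ∑ x : E, ∑ w : E, ψ (y * (x ^ 2 + a₀ * x * w + a₁ * w ^ 2)) = -Fintype.card E := by
  classical
  set P : E[X] := X ^ 2 + C a₀ * X + C a₁ with hP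
  have : Fact (Irreducible P) := ⟨hirr⟩
  have hdeg : P.natDegree = 2 := by
    rw [hP]
    compute_degree!
  have hmonic : P.Monic := by
    rw [hP]
    monicity!
  let pb := AdjoinRoot.powerBasis hirr.ne_zero
  have : Module.Finite E (AdjoinRoot P) := pb.finite
  have : Finite (AdjoinRoot P) := Module.finite_of_finite E
  have : Fintype (AdjoinRoot P) := Fintype.ofFinite _
  have hrank : Module.finrank E (AdjoinRoot P) = 2 := by
    rw [pb.finrank, AdjoinRoot.powerBasis_dim, hdeg]
  have hmin : minpoly E pb.gen = P := by
    rw [AdjoinRoot.minpoly_powerBasis_gen_of_monic hmonic]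
  have htr : Algebra.trace E (AdjoinRoot P) pb.gen = -a₀ := by
    rw [PowerBasis.trace_gen_eq_nextCoeff_minpoly, hmin, nextCoeff_of_natDegree_pos (by omega),
      hdeg, hP]
    simp [coeff_C]
  have hn : Algebra.norm E pb.gen = a₁ := by
    rw [Algebra.PowerBasis.norm_gen_eq_coeff_zero_minpoly, hmin, AdjoinRoot.powerBasis_dim, hdeg,
      hP]
    simp
  have hnorm := norm_sub_mul_of_trace_norm hrank htr hn
  let f : E × E → AdjoinRoot P := fun v =>
    algebraMap E (AdjoinRoot P) v.1 - algebraMap E (AdjoinRoot P) v.2 * pb.gen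
  have hroot : ∀ z : E, z ^ 2 + a₀ * z + a₁ ≠ 0 := by
    intro z hz
    have := degree_eq_one_of_irreducible_of_root hirr (x := z) (by
      rw [IsRoot.def, hP]
      simpa using hz)
    have h2 := natDegree_eq_of_degree_eq_some (n := 1) this
    rw [hdeg] at h2
    exact absurd h2 (by norm_num)
  have hzero : ∀ x w : E, f (x, w) = 0 → x = 0 ∧ w = 0 := by
    intro x w h0
    have h1 := hnorm x w
    change Algebra.norm E (f (x, w)) = _ at h1
    rw [h0, Algebra.norm_zero] at h1
    by_cases hw : w = 0
    · subst hw
      have : x ^ 2 = 0 := by simpa using h1.symm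
      exact ⟨pow_eq_zero_iff (by norm_num) |>.mp this, rfl⟩
    · exfalso
      apply hroot (x / w)
      field_simp
      linear_combination -h1
  have hbij : Function.Bijective f := by
    rw [Fintype.bijective_iff_injective_and_card]
    constructor
    · rintro ⟨x, w⟩ ⟨x', w'⟩ h
      have h0 : f (x - x', w - w') = 0 := by
        simp only [f, map_sub] at h ⊢
        linear_combination h
      obtain ⟨h1, h2⟩ := hzero _ _ h0
      rw [sub_eq_zero.mp h1, sub_eq_zero.mp h2]
    · rw [Module.card_eq_pow_finrank (K := E) (V := AdjoinRoot P), hrank, Fintype.card_prod,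
        _root_.sq]
  have key := sum_add_mul_add_sum_trace_norm hrank fun _ p => ψ (y * p)
  have e1 : ∑ x : E, ∑ z : E, ψ (y * (x * z)) = Fintype.card E := by
    have : ∀ x : E, ∑ z : E, ψ (y * (x * z)) = if x = 0 then (Fintype.card E : ℂ) else 0 := by
      intro x
      have h1 := AddChar.sum_mul_right_eq_ite hψ (y * x)
      have h2 : y * x = 0 ↔ x = 0 := by simp [hy]
      simp only [h2] at h1
      rw [← h1]
      exact Finset.sum_congr rfl fun z _ => by congr 1; ring
    rw [Finset.sum_congr rfl fun x _ => this x]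
    simp
  have e2 : ∑ p : E, ψ (y * p) = 0 := by
    have h1 := AddChar.sum_mul_right_eq_ite hψ y
    rw [if_neg hy] at h1
    rw [← h1]
    exact Finset.sum_congr rfl fun z _ => by rw [mul_comm]
  have e3 : ∑ z : AdjoinRoot P, ψ (y * Algebra.norm E z) =
      ∑ x : E, ∑ w : E, ψ (y * (x ^ 2 + a₀ * x * w + a₁ * w ^ 2)) := by
    rw [← Function.Bijective.sum_comp hbij fun z => ψ (y * Algebra.norm E z),
      Fintype.sum_prod_type]
    simp only [f, hnorm]
  rw [e1, e2, e3] at key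
  simp only [Finset.sum_const_zero, mul_zero] at key
  linear_combination key

/-- Each hyperbolic pair contributes a factor `|E|`, as summing over one of its coordinates forces
the other to vanish. -/
theorem sum_addChar_ellipticForm {a₀ a₁ : E}
    (hirr : Irreducible (X ^ 2 + C a₀ * X + C a₁ : E[X])) {ψ : AddChar E ℂ} (hψ : ψ ≠ 1) {y : E}
    (hy : y ≠ 0) (k : ℕ) :
    ∑ w, ψ (y * ellipticForm E k a₀ a₁ w) = -(Fintype.card E : ℂ) ^ (k + 1) := by
  classical
  induction k with
  | zero =>
    rw [← Equiv.sum_comp (finTwoArrowEquiv E).symm, Fintype.sum_prod_type, zero_add, pow_one,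
      ← sum_addChar_anisotropic hirr hψ hy]
    refine Finset.sum_congr rfl fun x _ => Finset.sum_congr rfl fun w _ => ?_
    rw [← ellipticForm_zero_apply]
    rfl
  | succ k ih =>
    refine (Equiv.sum_comp (Fin.consEquiv fun _ : Fin (2 * k + 2 + 1 + 1) => E)
      fun w => ψ (y * ellipticForm E (k + 1) a₀ a₁ w)).symm.trans ?_
    rw [Fintype.sum_prod_type]
    have h1 : ∀ x : E, ∑ v : Fin (2 * k + 2 + 1) → E,
        ψ (y * ellipticForm E (k + 1) a₀ a₁ (Fin.consEquiv (fun _ => E) (x, v))) =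
        ∑ z : E, ψ (z * (y * x)) * ∑ w, ψ (y * ellipticForm E k a₀ a₁ w) := by
      intro x
      rw [← Equiv.sum_comp (Fin.consEquiv fun _ : Fin (2 * k + 2 + 1) => E),
        Fintype.sum_prod_type]
      refine Finset.sum_congr rfl fun z _ => ?_
      rw [Finset.mul_sum]
      refine Finset.sum_congr rfl fun w _ => ?_
      rw [← AddChar.map_add_eq_mul]
      congr 1
      refine (congrArg (y * ·) (ellipticForm_succ_apply k a₀ a₁ x z w)).trans ?_
      ring
    refine (Finset.sum_congr rfl fun x _ => h1 x).trans ?_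
    simp_rw [← Finset.sum_mul, AddChar.sum_mul_right_eq_ite hψ, mul_eq_zero, hy, false_or, ih]
    rw [Finset.sum_ite_eq' Finset.univ (0 : E), if_pos (Finset.mem_univ _)]
    ring

variable {F : Type*} [Field F] [Fintype F] [Algebra F E]

theorem hasEllipticGaussSums_traceForm {a₀ a₁ : E}
    (hirr : Irreducible (X ^ 2 + C a₀ * X + C a₁ : E[X])) {ψ : AddChar F ℂ} (hψ : ψ ≠ 1)
    {k n : ℕ} (hn : n + 1 = Module.finrank F E * (k + 1)) :
    HasEllipticGaussSums (traceForm F (ellipticForm E k a₀ a₁)) ψ n := by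
  have hcE : Fintype.card E = Fintype.card F ^ Module.finrank F E := Module.card_eq_pow_finrank
  constructor
  · rw [Fintype.card_fun, Fintype.card_fin, hcE, ← pow_mul]
    congr 1
    rw [show 2 * n + 2 = 2 * (n + 1) by ring, hn]
    ring
  · intro c hc
    have h1 := sum_addChar_ellipticForm hirr (AddChar.compTrace_ne_one (L := E) hψ)
      ((map_ne_zero (algebraMap F E)).mpr hc) k
    rw [hcE, Nat.cast_pow, ← pow_mul, ← hn] at h1
    rw [← h1]
    refine Finset.sum_congr rfl fun w _ => ?_
    rw [AddChar.compTrace_apply, traceForm_apply, ← Algebra.smul_def, map_smul, smul_eq_mul]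

open Classical in
/-- The exponential sum over the quadric `Q' = c` is a Kloosterman sum. -/
theorem sum_polar_ellipticForm_eq {a₀ a₁ : E}
    (hirr : Irreducible (X ^ 2 + C a₀ * X + C a₁ : E[X])) {ψ : AddChar E ℂ} (hψ : ψ ≠ 1) (k : ℕ)
    {v : Fin (2 * k + 2) → E} (hv : ∑ w, ψ (polar (ellipticForm E k a₀ a₁) v w) = 0) {c : E}
    (hc : c ≠ 0) :
    (Fintype.card E : ℂ) * ∑ w ∈ Finset.univ.filter fun w => ellipticForm E k a₀ a₁ w = c,
        ψ (polar (ellipticForm E k a₀ a₁) v w) =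
      -(Fintype.card E : ℂ) ^ (k + 1) * kloosterman ψ (ellipticForm E k a₀ a₁ v * c) := by
  set Q := ellipticForm E k a₀ a₁
  have h1 : ∑ y : E, ∑ w, ψ (y * Q w + polar Q v w) * ψ (-(y * c)) =
      (Fintype.card E : ℂ) * ∑ w ∈ Finset.univ.filter fun w => Q w = c, ψ (polar Q v w) := by
    rw [Finset.sum_comm, Finset.mul_sum, Finset.sum_filter]
    refine Finset.sum_congr rfl fun w _ => ?_
    have : ∀ y : E, ψ (y * Q w + polar Q v w) * ψ (-(y * c)) =
        ψ (y * (Q w - c)) * ψ (polar Q v w) := by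
      intro y
      rw [← AddChar.map_add_eq_mul, ← AddChar.map_add_eq_mul]
      congr 1
      ring
    rw [Finset.sum_congr rfl fun y _ => this y, ← Finset.sum_mul,
      AddChar.sum_mul_right_eq_ite hψ]
    simp only [sub_eq_zero]
    split_ifs <;> simp
  -- Completing the square leaves the phase `-Q(v)/y - yc`, which is `x + Q(v)c/x` for `x = -yc`.
  -- The term `y = 0` vanishes by `hv`.
  rw [← h1, kloosterman, ← Equiv.sum_comp ((Equiv.mulRight₀ c hc).trans (Equiv.neg E))
    fun x => if x = 0 then 0 else ψ (x + Q v * c / x), Finset.mul_sum]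
  refine Finset.sum_congr rfl fun y _ => ?_
  rw [← Finset.sum_mul]
  by_cases hy : y = 0
  · simp [hy, hv]
  · have hyc : -(y * c) ≠ 0 := neg_ne_zero.mpr (mul_ne_zero hy hc)
    rw [sum_addChar_mul_add_polar Q ψ hy, sum_addChar_ellipticForm hirr hψ hy k]
    simp only [Equiv.trans_apply, Equiv.neg_apply, Equiv.mulRight₀_apply, if_neg hyc]
    have : -(y * c) + Q v * c / -(y * c) = -(Q v / y) + -(y * c) := by
      field_simp
      ring
    rw [this, AddChar.map_add_eq_mul]
    ring

end EllipticForm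

/-! ### The size of a union of square classes. -/

section CosetCount

open Classical in
-- For odd `q` every nonzero square has at least two square roots.
theorem card_nonzeroSquares_le (F : Type*) [Field F] [Fintype F] :
    ((Finset.univ.filter fun c : F => c ∈ nonzeroSquares F).card : ℝ) ≤
      parityFactor (Fintype.card F) * ((Fintype.card F : ℝ) - 1) := by
  set N := Finset.univ.filter fun c : F => c ∈ nonzeroSquares F with hN
  set U := Finset.univ.erase (0 : F) with hU
  have hUcard : (U.card : ℝ) = (Fintype.card F : ℝ) - 1 := by
    rw [hU, Finset.card_erase_of_mem (Finset.mem_univ _), Finset.card_univ,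
      Nat.cast_sub Fintype.card_pos, Nat.cast_one]
  rw [← hUcard, parityFactor]
  split_ifs with hodd
  · have hmaps : ∀ c ∈ U, c ^ 2 ∈ N := by
      intro c hc
      have hc0 := Finset.ne_of_mem_erase hc
      simp only [hN, Finset.mem_filter, Finset.mem_univ, true_and]
      exact ⟨pow_ne_zero 2 hc0, c, sq c⟩
    have hchar : ringChar F ≠ 2 := by
      intro h
      have := FiniteField.even_card_of_char_two h
      rw [Nat.odd_iff] at hodd
      omega
    have h2 : ∀ s ∈ N, 2 ≤ (U.filter fun c => c ^ 2 = s).card := by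
      intro s hs
      simp only [hN, Finset.mem_filter, Finset.mem_univ, true_and] at hs
      obtain ⟨hs0, r, rfl⟩ := hs
      have hr : r ≠ 0 := fun h => hs0 (by simp [h])
      have hne : r ≠ -r :=
      Ne.symm fun h => hr ((Ring.eq_self_iff_eq_zero_of_char_ne_two hchar).mp h)
      refine (Finset.card_pair hne).ge.trans ?_
      refine Finset.card_le_card fun c hc => ?_
      simp only [Finset.mem_insert, Finset.mem_singleton] at hc
      rcases hc with rfl | rfl <;> simp [hU, hr, pow_two]
    have h3 := Finset.card_nsmul_le_sum N _ 2 h2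
    rw [← Finset.card_eq_sum_card_fiberwise hmaps, smul_eq_mul] at h3
    have h4 : (N.card : ℝ) * 2 ≤ U.card := by exact_mod_cast h3
    linarith
  · rw [one_mul, Nat.cast_le]
    refine Finset.card_le_card fun c hc => ?_
    simp only [hN, Finset.mem_filter, Finset.mem_univ, true_and] at hc
    exact Finset.mem_erase.mpr ⟨hc.1, Finset.mem_univ _⟩

open Classical in
theorem IsSquareCosetReps.card_le {F E : Type*} [Field F] [Fintype F] [Field E] [Fintype E]
    [Algebra F E] {S : Set E} {T : Finset E} (hT : IsSquareCosetReps F S T) :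
    ((Finset.univ.filter (· ∈ S)).card : ℝ) ≤
      parityFactor (Fintype.card F) * ((Fintype.card F : ℝ) - 1) * T.card := by
  have hsub : Finset.univ.filter (· ∈ S) ⊆
      ((Finset.univ.filter fun c : F => c ∈ nonzeroSquares F) ×ˢ T).image
        fun v => v.1 • v.2 := by
    intro x hx
    obtain ⟨t, ⟨ht, c, hc, rfl⟩, -⟩ := hT.2 x (by simpa using hx)
    exact Finset.mem_image.mpr ⟨(c, t), by simpa using ⟨hc, ht⟩, rfl⟩
  have h1 := (Finset.card_le_card hsub).trans Finset.card_image_le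
  rw [Finset.card_product] at h1
  calc ((Finset.univ.filter (· ∈ S)).card : ℝ)
      ≤ ((Finset.univ.filter fun c : F => c ∈ nonzeroSquares F).card : ℝ) * T.card := by
        exact_mod_cast h1
    _ ≤ _ := mul_le_mul_of_nonneg_right (card_nonzeroSquares_le F) (Nat.cast_nonneg _)

end CosetCount

/-! ### From points to vectors, and the character sum over a cone. -/

section Points

open QuadraticMap

variable {F V : Type*} [Field F] [Fintype F] [AddCommGroup V] [Module F V] [Fintype V]

open Classical in
theorem card_filter_span_singleton_eq {v : V} (hv : v ≠ 0) :
    (Finset.univ.filter fun w : V => Submodule.span F {w} = Submodule.span F {v}).card =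
      Fintype.card F - 1 := by
  have h : (Finset.univ.filter fun w : V => Submodule.span F {w} = Submodule.span F {v}) =
      (Finset.univ.erase (0 : F)).image fun c => c • v := by
    ext w
    simp only [Finset.mem_filter, Finset.mem_univ, true_and, Finset.mem_image, Finset.mem_erase,
      and_true]
    constructor
    · intro hw
      obtain ⟨c, rfl⟩ := Submodule.mem_span_singleton.mp
        (hw ▸ Submodule.mem_span_singleton_self w : w ∈ Submodule.span F {v})
      refine ⟨c, ?_, rfl⟩
      rintro rfl
      rw [zero_smul, Submodule.span_zero_singleton, eq_comm, Submodule.span_singleton_eq_bot] at hw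
      exact hv hw
    · rintro ⟨c, hc, rfl⟩
      exact Submodule.span_singleton_smul_eq (IsUnit.mk0 c hc) v
  rw [h, Finset.card_image_of_injective _ (smul_left_injective F hv),
    Finset.card_erase_of_mem (Finset.mem_univ _), Finset.card_univ]

open Classical in
/-- A set of vectors closed under nonzero scalars consists of `q - 1` vectors for each point. -/
theorem card_filter_mem_eq_mul {X : Finset V} (h0 : (0 : V) ∉ X)
    (hX : ∀ c : F, c ≠ 0 → ∀ x ∈ X, c • x ∈ X) (W : Submodule F V) {m : ℕ}
    (hm : {P : Submodule F V | P ∈ {P | ∃ v ∈ X, P = Submodule.span F {v}} ∧ P ≤ W}.encard = m) :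
    (X.filter (· ∈ W)).card = (Fintype.card F - 1) * m := by
  have himg : {P : Submodule F V | P ∈ {P | ∃ v ∈ X, P = Submodule.span F {v}} ∧ P ≤ W} =
      ((X.filter (· ∈ W)).image fun v => Submodule.span F {v} : Finset (Submodule F V)) := by
    ext P
    simp only [Set.mem_ofPred_eq, Finset.coe_image, Set.mem_image, Finset.mem_coe,
      Finset.mem_filter]
    constructor
    · rintro ⟨⟨v, hv, rfl⟩, hW⟩
      exact ⟨v, ⟨hv, hW (Submodule.mem_span_singleton_self v)⟩, rfl⟩
    · rintro ⟨v, ⟨hv, hW⟩, rfl⟩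
      exact ⟨⟨v, hv, rfl⟩, (Submodule.span_singleton_le_iff_mem v W).mpr hW⟩
  rw [himg, Set.encard_coe_eq_coe_finsetCard] at hm
  have hm' := ENat.natCast_inj.mp hm
  rw [Finset.card_eq_sum_card_image (fun v => Submodule.span F {v}), ← hm', mul_comm,
    ← smul_eq_mul]
  refine Finset.sum_const_nat fun P hP => ?_
  obtain ⟨v, hv, rfl⟩ := Finset.mem_image.mp hP
  rw [Finset.mem_filter] at hv
  have hv0 : v ≠ 0 := fun h => h0 (h ▸ hv.1)
  rw [← card_filter_span_singleton_eq (F := F) hv0]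
  congr 1
  ext w
  simp only [Finset.mem_filter, Finset.mem_univ, true_and]
  refine ⟨fun h => h.2, fun h => ⟨?_, h⟩⟩
  obtain ⟨c, rfl⟩ := Submodule.mem_span_singleton.mp
    (h ▸ Submodule.mem_span_singleton_self w : w ∈ Submodule.span F {v})
  have hc : c ≠ 0 := by
    rintro rfl
    rw [zero_smul, Submodule.span_zero_singleton, eq_comm, Submodule.span_singleton_eq_bot] at h
    exact hv0 h
  exact ⟨hX c hc v hv.1, W.smul_mem c hv.2⟩

open Classical in
/-- The exponential sum of a cone over a hyperplane section. -/
theorem card_sub_one_mul_sum_polar {ψ : AddChar F ℂ} (hψ : ψ ≠ 1) (Q : QuadraticForm F V)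
    {X : Finset V} (hX : ∀ c : F, c ≠ 0 → ∀ x ∈ X, c • x ∈ X) (v : V) :
    ((Fintype.card F : ℂ) - 1) * ∑ x ∈ X, ψ (polar Q v x) =
      Fintype.card F * (X.filter fun x => polar Q v x = 0).card - X.card := by
  have h1 : ∑ c : F, ∑ x ∈ X, ψ (c * polar Q v x) =
      Fintype.card F * (X.filter fun x => polar Q v x = 0).card := by
    rw [Finset.sum_comm, Finset.card_filter, Nat.cast_sum, Finset.mul_sum]
    refine Finset.sum_congr rfl fun x _ => ?_
    rw [AddChar.sum_mul_right_eq_ite hψ]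
    split_ifs <;> simp
  have h2 : ∀ c ∈ Finset.univ.erase (0 : F), ∑ x ∈ X, ψ (c * polar Q v x) =
      ∑ x ∈ X, ψ (polar Q v x) := by
    intro c hc
    have hc0 := Finset.ne_of_mem_erase hc
    refine Finset.sum_bij (fun x _ => c • x) (fun x hx => hX c hc0 x hx)
      (fun x _ y _ h => (smul_right_injective V hc0) h)
      (fun y hy => ⟨c⁻¹ • y, hX _ (inv_ne_zero hc0) y hy, ?_⟩) fun x _ => ?_
    · rw [smul_smul, mul_inv_cancel₀ hc0, one_smul]
    · rw [polar_smul_right, smul_eq_mul]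
  rw [← h1, ← Finset.add_sum_erase _ _ (Finset.mem_univ (0 : F)), Finset.sum_congr rfl h2,
    Finset.sum_const, Finset.card_erase_of_mem (Finset.mem_univ _), Finset.card_univ,
    nsmul_eq_mul, Nat.cast_sub Fintype.card_pos]
  simp

open Classical in
/-- The Fourier transform, at one of its vectors, of a cone that meets all generators in `μ`
vectors. -/
theorem HasEllipticGaussSums.sum_polar_eq {Q : QuadraticForm F V} {ψ : AddChar F ℂ} {n : ℕ}
    (hQ : HasEllipticGaussSums Q ψ (n + 1)) (hψ : ψ ≠ 1) {X : Finset V} (h0 : (0 : V) ∉ X)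
    (hXs : ∀ c : F, c ≠ 0 → ∀ x ∈ X, c • x ∈ X) (hX : ∀ x ∈ X, Q x = 0) {μ : ℕ}
    (hμ : ∀ W, IsGenerator Q W → (X.filter (· ∈ W)).card = μ) {v : V} (hv : v ∈ X) :
    ∑ x ∈ X, ψ (polar Q v x) = μ - (Fintype.card F : ℂ) ^ (n + 2) := by
  have hv0 : v ≠ 0 := fun h => h0 (h ▸ hv)
  have hbot : TotallySingular Q (⊥ : Submodule F V) := by
    intro w hw
    rw [(Submodule.mem_bot F).mp hw, QuadraticMap.map_zero]
  have hts : TotallySingular Q (Submodule.span F {v}) := by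
    have := hbot.sup_span_singleton (hX v hv) (y := v) fun u hu => by
      rw [(Submodule.mem_bot F).mp hu, polar_zero_left]
    rwa [bot_sup_eq] at this
  -- The zero subspace yields `|X|`. The line `⟨v⟩`, which contains `q - 1` vectors of `X`, yields
  -- `|X ∩ v^⊥|`.
  have h1 := hQ.card_inter_perp_sub hψ X hX μ hμ (n + 1) 0 ⊥ hbot (finrank_bot F V) (by omega)
  have h2 := hQ.card_inter_perp_sub hψ X hX μ hμ n 1 _ hts (finrank_span_singleton hv0) (by omega)
  have e1 : (X.filter fun x => ∀ u ∈ (⊥ : Submodule F V), polar Q u x = 0) = X := by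
    refine Finset.filter_true_of_mem fun x _ u hu => ?_
    rw [(Submodule.mem_bot F).mp hu, polar_zero_left]
  have e2 : (X.filter (· ∈ (⊥ : Submodule F V))).card = 0 := by
    rw [Finset.card_eq_zero, Finset.filter_eq_empty_iff]
    intro x hx hx0
    exact h0 ((Submodule.mem_bot F).mp hx0 ▸ hx)
  have e3 : (X.filter fun x => ∀ u ∈ Submodule.span F {v}, polar Q u x = 0) =
      X.filter fun x => polar Q v x = 0 := by
    refine Finset.filter_congr fun x _ => ⟨fun h => h v (Submodule.mem_span_singleton_self v),
      fun h u hu => ?_⟩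
    obtain ⟨c, rfl⟩ := Submodule.mem_span_singleton.mp hu
    rw [polar_smul_left, h, smul_zero]
  have e4 : (X.filter (· ∈ Submodule.span F {v})).card = Fintype.card F - 1 := by
    rw [← card_filter_span_singleton_eq (F := F) hv0]
    congr 1
    ext w
    simp only [Finset.mem_filter, Finset.mem_univ, true_and]
    constructor
    · rintro ⟨hw, hwv⟩
      obtain ⟨c, rfl⟩ := Submodule.mem_span_singleton.mp hwv
      have hc : c ≠ 0 := by
        rintro rfl
        rw [zero_smul] at hw
        exact h0 hw
      exact Submodule.span_singleton_smul_eq (IsUnit.mk0 c hc) v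
    · intro h
      have hw : w ∈ Submodule.span F {v} := h ▸ Submodule.mem_span_singleton_self w
      refine ⟨?_, hw⟩
      obtain ⟨c, rfl⟩ := Submodule.mem_span_singleton.mp hw
      refine hXs c ?_ v hv
      rintro rfl
      rw [zero_smul, Submodule.span_zero_singleton, eq_comm, Submodule.span_singleton_eq_bot] at h
      exact hv0 h
  rw [e1, e2] at h1
  rw [e3, e4, Nat.cast_sub Fintype.card_pos] at h2
  have h3 := card_sub_one_mul_sum_polar hψ Q hXs v
  have hq : (Fintype.card F : ℂ) - 1 ≠ 0 :=
    sub_ne_zero.mpr (by exact_mod_cast Fintype.one_lt_card.ne')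
  have h1' := congrArg (fun r : ℝ => (r : ℂ)) h1
  have h2' := congrArg (fun r : ℝ => (r : ℂ)) h2
  push_cast at h1' h2'
  refine mul_left_cancel₀ hq (h3.trans ?_)
  linear_combination (Fintype.card F : ℂ) * h2' - h1'

end Points

/-! ### Comparison of the two evaluations. -/

section Main

open QuadraticMap

open Classical in
theorem card_field_le_of_isMOvoid {F E : Type*} [Field F] [Fintype F] [Field E] [Fintype E]
    [Algebra F E] {k : ℕ} (hk : 1 ≤ k) {a₀ a₁ : E}
    (hirr : Irreducible
      (Polynomial.X ^ 2 + Polynomial.C a₀ * Polynomial.X + Polynomial.C a₁ : Polynomial E))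
    {S : Set E} (hS0 : ∀ x ∈ S, x ≠ 0) (hSinv : ∀ c ∈ nonzeroSquares F, ∀ x ∈ S, c • x ∈ S)
    (hStr : ∀ x ∈ S, Algebra.trace F E x = 0) (hSne : S.Nonempty) {m : ℕ}
    (hM : IsMOvoid (traceForm F (ellipticForm E k a₀ a₁)) m
      (pointsWithValueIn F (ellipticForm E k a₀ a₁) S)) :
    (Fintype.card E : ℝ) ^ (k + 1) ≤ ((Fintype.card F : ℝ) - 1) * m +
      (Fintype.card E : ℝ) ^ k * ((Finset.univ.filter (· ∈ S)).card *
        (2 * √(Fintype.card E : ℝ))) := by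
  set Q := ellipticForm E k a₀ a₁ with hQdef
  set X : Finset (Fin (2 * k + 2) → E) := Finset.univ.filter fun w => Q w ∈ S with hX
  have hXmem : ∀ w, w ∈ X ↔ Q w ∈ S := by
    intro w
    simp [hX]
  have h0 : (0 : Fin (2 * k + 2) → E) ∉ X := by
    rw [hXmem, QuadraticMap.map_zero]
    exact fun h => hS0 0 h rfl
  have hXs : ∀ c : F, c ≠ 0 → ∀ x ∈ X, c • x ∈ X := by
    intro c hc x hx
    rw [hXmem] at hx ⊢
    rw [QuadraticMap.map_smul_of_tower]
    exact hSinv _ ⟨mul_ne_zero hc hc, c, rfl⟩ _ hx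
  have hXsing : ∀ x ∈ X, traceForm F Q x = 0 := fun x hx => by
    rw [traceForm_apply]
    exact hStr _ ((hXmem x).mp hx)
  have hpts : pointsWithValueIn F Q S =
      {P | ∃ v ∈ X, P = Submodule.span F {v}} := by
    ext P
    constructor
    · rintro ⟨v, -, hv, rfl⟩
      exact ⟨v, (hXmem v).mpr hv, rfl⟩
    · rintro ⟨v, hv, rfl⟩
      exact ⟨v, fun h => h0 (h ▸ hv), (hXmem v).mp hv, rfl⟩
  have hμ : ∀ W, IsGenerator (traceForm F Q) W →
      (X.filter (· ∈ W)).card = (Fintype.card F - 1) * m := by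
    intro W hW
    apply card_filter_mem_eq_mul h0 hXs W
    rw [← hpts]
    exact hM.2 W hW
  obtain ⟨u, hu⟩ := hSne
  -- Because `k ≥ 1`, the first hyperbolic pair, at `(1, u)`, represents `u`.
  obtain ⟨v, hv⟩ : ∃ v, Q v = u := by
    obtain ⟨k, rfl⟩ := Nat.exists_eq_add_of_le' hk
    refine ⟨Fin.cons 1 (Fin.cons u (0 : Fin (2 * k + 2) → E) : Fin (2 * k + 2 + 1) → E), ?_⟩
    rw [hQdef, ellipticForm_succ_apply, QuadraticMap.map_zero, one_mul, add_zero]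
  have hvX : v ∈ X := (hXmem v).mpr (hv ▸ hu)
  have hv0 : v ≠ 0 := fun h => h0 (h ▸ hvX)
  have hb : 1 ≤ Module.finrank F E := Module.finrank_pos
  -- The `F`-dimension is `2(n + 1) + 2`, so the generator dimension `n + 1` is positive and leaves
  -- room for the line `⟨v⟩`.
  obtain ⟨n, hn⟩ : ∃ n, n + 1 + 1 = Module.finrank F E * (k + 1) := by
    have : 2 ≤ Module.finrank F E * (k + 1) :=
      le_trans (by omega) (Nat.mul_le_mul hb (le_refl (k + 1)))
    exact ⟨Module.finrank F E * (k + 1) - 2, by omega⟩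
  obtain ⟨ψ, hψ⟩ : ∃ ψ : AddChar F ℂ, ψ ≠ 1 :=
    (AddChar.exists_apply_ne_zero.mpr (one_ne_zero (α := F))).imp
      fun ψ h => AddChar.ne_one_iff.mpr ⟨1, h⟩
  have hψE := AddChar.compTrace_ne_one (L := E) hψ
  have hG := hasEllipticGaussSums_traceForm hirr hψ hn
  have hfour := hG.sum_polar_eq hψ h0 hXs hXsing hμ hvX
  have hcE : (Fintype.card E : ℂ) ^ (k + 1) = (Fintype.card F : ℂ) ^ (n + 2) := by
    rw [Module.card_eq_pow_finrank (K := F) (V := E), Nat.cast_pow, ← pow_mul, ← hn]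
  have hpol : ∀ w, ψ (polar (traceForm F Q) v w) = ψ.compTrace E (polar Q v w) := fun w => by
    rw [polar_traceForm, AddChar.compTrace_apply]
  have hv2 : ∑ w, ψ.compTrace E (polar Q v w) = 0 := by
    have := hG.sum_polar hψ v
    rw [if_neg hv0] at this
    rw [← this]
    exact Finset.sum_congr rfl fun w _ => (hpol w).symm
  -- `X` is split according to the value `c ∈ S` of `Q'`.
  have hfib : ∑ x ∈ X, ψ (polar (traceForm F Q) v x) =
      ∑ c ∈ Finset.univ.filter (· ∈ S), ∑ w ∈ Finset.univ.filter fun w => Q w = c,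
        ψ.compTrace E (polar Q v w) := by
    rw [← Finset.sum_fiberwise_of_maps_to (s := X) (t := Finset.univ.filter (· ∈ S)) (g := Q)
      (fun x hx => by simpa using (hXmem x).mp hx)]
    refine Finset.sum_congr rfl fun c hc => Finset.sum_congr ?_ fun w _ => hpol w
    ext w
    simp only [Finset.mem_filter, Finset.mem_univ, true_and, hXmem] at hc ⊢
    exact ⟨fun h => h.2, fun h => ⟨h ▸ hc, h⟩⟩
  have hN0 : (Fintype.card E : ℝ) ≠ 0 := Nat.cast_ne_zero.mpr Fintype.card_ne_zero
  have key : (Fintype.card E : ℂ) *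
      (((Fintype.card F - 1) * m : ℕ) - (Fintype.card E : ℂ) ^ (k + 1)) =
      -(Fintype.card E : ℂ) ^ (k + 1) *
        ∑ c ∈ Finset.univ.filter (· ∈ S), kloosterman (ψ.compTrace E) (u * c) := by
    rw [hcE, ← hfour, hfib, Finset.mul_sum, Finset.mul_sum, ← hcE]
    refine Finset.sum_congr rfl fun c hc => ?_
    rw [sum_polar_ellipticForm_eq hirr hψE k hv2 (hS0 c (by simpa using hc)), ← hQdef, hv]
  have keyR : (Fintype.card E : ℝ) *
      (((Fintype.card F : ℝ) - 1) * m - (Fintype.card E : ℝ) ^ (k + 1)) =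
      -(Fintype.card E : ℝ) ^ (k + 1) *
        ∑ c ∈ Finset.univ.filter (· ∈ S), (kloosterman (ψ.compTrace E) (u * c)).re := by
    rw [Finset.sum_congr rfl fun c _ => (ofReal_re_kloosterman (ψ.compTrace E) (u * c)).symm,
      Nat.cast_mul, Nat.cast_sub Fintype.card_pos] at key
    exact_mod_cast key
  have hbound : ∑ c ∈ Finset.univ.filter (· ∈ S), (kloosterman (ψ.compTrace E) (u * c)).re ≤
      (Finset.univ.filter (· ∈ S)).card * (2 * √(Fintype.card E : ℝ)) := by
    rw [← nsmul_eq_mul]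
    refine Finset.sum_le_card_nsmul _ _ _ fun c hc => ?_
    exact (le_abs_self _).trans
      (abs_re_kloosterman_le hψ (mul_ne_zero (hS0 u hu) (hS0 c (by simpa using hc))))
  have h1 : ((Fintype.card F : ℝ) - 1) * m - (Fintype.card E : ℝ) ^ (k + 1) =
      -(Fintype.card E : ℝ) ^ k *
        ∑ c ∈ Finset.univ.filter (· ∈ S), (kloosterman (ψ.compTrace E) (u * c)).re := by
    apply mul_left_cancel₀ hN0
    rw [keyR, pow_succ]
    ring
  have h2 := mul_le_mul_of_nonneg_left hbound
    (pow_nonneg (Nat.cast_nonneg (α := ℝ) (Fintype.card E)) k)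
  linarith

theorem mainTheorem10 {F E : Type*} [Field F] [Fintype F] [Field E] [Fintype E] [Algebra F E]
    (q b d k : ℕ) (hq : Fintype.card F = q) (hb : Module.finrank F E = b)
    (hd : d = b * (2 * k + 2)) (hk : 4 ≤ 2 * k + 2)
    (a₀ a₁ : E)
    (hirr : Irreducible
      (Polynomial.X ^ 2 + Polynomial.C a₀ * Polynomial.X + Polynomial.C a₁ : Polynomial E))
    (S : Set E) (hS0 : ∀ x ∈ S, x ≠ 0)
    (hSinv : ∀ c ∈ nonzeroSquares F, ∀ x ∈ S, c • x ∈ S)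
    (hStr : ∀ x ∈ S, Algebra.trace F E x = 0)
    (T : Finset E) (hT : IsSquareCosetReps F S T) (hTne : T.Nonempty)
    (m : ℕ) (hm : (m : ℝ) = parityFactor q * T.card * (q : ℝ) ^ (d / 2 - b))
    (hM : IsMOvoid (traceForm F (ellipticForm E k a₀ a₁)) m
      (pointsWithValueIn F (ellipticForm E k a₀ a₁) S)) :
    (T.card : ℝ) ≥
      (q : ℝ) ^ b / (parityFactor q * ((q : ℝ) - 1) * (2 * (q : ℝ) ^ ((b : ℝ) / 2) + 1)) := by
  classical
  have hSne : S.Nonempty := hTne.imp fun t ht => hT.1 ht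
  have hmain := card_field_le_of_isMOvoid (by omega) hirr hS0 hSinv hStr hSne hM
  have hcard := hT.card_le
  have hcE : (Fintype.card E : ℝ) = (q : ℝ) ^ b := by
    rw [← hb, ← hq]
    exact_mod_cast Module.card_eq_pow_finrank (K := F) (V := E)
  have hexp : d / 2 - b = b * k := by
    rw [hd, show b * (2 * k + 2) = 2 * (b * k + b) by ring, Nat.mul_div_cancel_left _ two_pos,
      Nat.add_sub_cancel]
  have hq1 : (1 : ℝ) < q := by
    rw [← hq]
    exact_mod_cast Fintype.one_lt_card (α := F)
  have hsqrt : √((q : ℝ) ^ b) = (q : ℝ) ^ ((b : ℝ) / 2) := by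
    rw [Real.sqrt_eq_rpow, ← Real.rpow_natCast, ← Real.rpow_mul (by linarith)]
    congr 1
    ring
  rw [hq] at hmain hcard
  rw [hm, hexp, hcE, hsqrt, ← pow_mul, ← pow_mul] at hmain
  set ε := parityFactor q with hε
  have hε0 : 0 < ε := by
    rw [hε, parityFactor]
    split_ifs <;> norm_num
  set r : ℝ := (q : ℝ) ^ ((b : ℝ) / 2) with hr
  have hr0 : 0 < r := Real.rpow_pos_of_pos (by linarith) _
  have hden : 0 < ε * ((q : ℝ) - 1) * (2 * r + 1) :=
    mul_pos (mul_pos hε0 (by linarith)) (by linarith)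
  have hpow : 0 < (q : ℝ) ^ (b * k) := pow_pos (by linarith) _
  rw [ge_iff_le, div_le_iff₀ hden]
  refine le_of_mul_le_mul_left ?_ hpow
  have h1 : (q : ℝ) ^ (b * k) * (q : ℝ) ^ b = (q : ℝ) ^ (b * (k + 1)) := by
    rw [← pow_add]
    congr 1
  rw [h1]
  -- The bound on `|S|` enters only the Weil term; the ovoid term already has the factor `ε (q - 1)
  -- |T|` through `m`.
  have h2 := mul_le_mul_of_nonneg_left
    (mul_le_mul_of_nonneg_right hcard (by linarith : 0 ≤ 2 * r)) hpow.le
  refine hmain.trans ?_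
  linarith

end Main
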